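/- Let $n$ be a natural number, $\alpha\in[0,1]$, and let $X_1,X_2,Z_1,Z_2$ be mutually independent random vectors in $\mathbb{R}^n$ such that $X_1$ and $X_2$ have (Lebesgue) probability densities and finite second moments, and $Z_1,Z_2\sim\mathcal N(0,I_n)$. Put $$X=\sqrt{1-\alpha}\,X_1+\sqrt{\alpha}\,X_2,\qquad Y_{i,\gamma}=\sqrt{\gamma}\,X_i+Z_i\quad(i=1,2,\ \gamma>0),$$ $$\Delta(X_1\|X_2)=\frac12\int_0^\infty \mathbb E\Big[\big\|\,\mathbb E[X\mid \sqrt{1-\alpha}\,Y_{1,\gamma}+\sqrt{\alpha}\,Y_{2,\gamma}]-\mathbb E[X\mid Y_{1,\gamma},Y_{2,\gamma}]\,\big\|^2\Big]\,d\gamma\in[0,\infty],$$ and write $h(V)=-\int f_V\log f_V$ for the differential entropy of a random vector $V$ with density $f_V$. Then $X$ has a density, the entropies $h(X_1),h(X_2),h(X)$ are well defined in $[-\infty,\infty)$, and $$h\big(\sqrt{1-\alpha}\,X_1+\sqrt{\alpha}\,X_2\big)=(1-\alpha)\,h(X_1)+\alpha\,h(X_2)+\Delta(X_1\|X_2),$$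 with the convention $0\cdot(-\infty)=0$, whenever the right-hand side is not of the undefined form $-\infty+\infty$ (in particular whenever $h(X_1)$ and $h(X_2)$ are finite). Consequently, in all cases, $h(\sqrt{1-\alpha}\,X_1+\sqrt{\alpha}\,X_2)\ge(1-\alpha)h(X_1)+\alpha h(X_2)$ (Lieb's form of the entropy power inequality). -/

import Mathlib

open MeasureTheory ProbabilityTheory Set
open scoped ENNReal

noncomputable section

namespace EPI

/-- Euclidean space `ℝⁿ`. -/
abbrev Vec (n : ℕ) : Type := EuclideanSpace ℝ (Fin n)

variable {n : ℕ} {Ω : Type*} [MeasurableSpace Ω]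

/-- The Lebesgue density of an absolutely continuous law `μ` on `ℝⁿ`. -/
def density (μ : Measure (Vec n)) (x : Vec n) : ℝ := (μ.rnDeriv volume x).toReal

/-- `∫ (-f log f)⁺`, with `f` the density of `μ` and `0 log 0 = 0`. -/
def entropyPos (μ : Measure (Vec n)) : ℝ≥0∞ :=
  ∫⁻ x, ENNReal.ofReal (Real.negMulLog (density μ x))

/-- `∫ (-f log f)⁻`, with `f` the density of `μ` and `0 log 0 = 0`. -/
def entropyNeg (μ : Measure (Vec n)) : ℝ≥0∞ :=
  ∫⁻ x, ENNReal.ofReal (-Real.negMulLog (density μ x))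

/-- The law `μ` has a density `f`, and its differential entropy `-∫ f log f` is well defined as
an element of `[-∞, ∞)`. -/
def HasEntropy (μ : Measure (Vec n)) : Prop :=
  μ ≪ volume ∧ entropyPos μ ≠ ∞

/-- The differential entropy `h(X) = -∫ f log f` (in nats) of a random vector `X` with density `f`,
as an extended real number; it is meaningful when `HasEntropy (P.map X)`. -/
def entropy (P : Measure Ω) (X : Ω → Vec n) : EReal :=
  (entropyPos (P.map X) : EReal) - (entropyNeg (P.map X) : EReal)

/-- The combination `√(1-α) U + √α V`. -/
def mix (α : ℝ) (U V : Ω → Vec n) (ω : Ω) : Vec n :=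
  √(1 - α) • U ω + √α • V ω

/-- The output `√γ X + Z` of the Gaussian noise channel with input `X`. -/
def channel (γ : ℝ) (X Z : Ω → Vec n) (ω : Ω) : Vec n :=
  √γ • X ω + Z ω

/-- The conditional expectation `E[X | Y]` of `X` given the σ-algebra generated by `Y`. -/
def condGiven {F : Type*} [MeasurableSpace F] (P : Measure Ω) (X : Ω → Vec n) (Y : Ω → F) :
    Ω → Vec n :=
  P[X | MeasurableSpace.comap Y inferInstance]

/-- `E ‖E[X | √(1-α) Y₁ + √α Y₂] - E[X | Y₁, Y₂]‖²`, where `X = √(1-α) X₁ + √α X₂` and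
`Yᵢ = √γ Xᵢ + Zᵢ`. -/
def estimationGap (P : Measure Ω) (X₁ X₂ Z₁ Z₂ : Ω → Vec n) (α γ : ℝ) : ℝ≥0∞ :=
  ∫⁻ ω, ‖condGiven P (mix α X₁ X₂) (mix α (channel γ X₁ Z₁) (channel γ X₂ Z₂)) ω
      - condGiven P (mix α X₁ X₂) (fun ω' => (channel γ X₁ Z₁ ω', channel γ X₂ Z₂ ω')) ω‖ₑ ^ 2 ∂P

/-- The deficit `Δ(X₁ ‖ X₂) = (1/2) ∫₀^∞ estimationGap dγ`, an element of `[0, ∞]`. -/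
def deficit (P : Measure Ω) (X₁ X₂ Z₁ Z₂ : Ω → Vec n) (α : ℝ) : ℝ≥0∞ :=
  2⁻¹ * ∫⁻ γ in Ioi (0 : ℝ), estimationGap P X₁ X₂ Z₁ Z₂ α γ

end EPI

end

-- Entropy has an exact derivative along Gaussian noise, and the deficit is the integral of a
-- difference of such derivatives. Let t = 1/γ be the noise variance and W = √t Z. De Bruijn's
-- identity (`hasDerivAt_noisyEntropy`) gives d/dt h(X + W) = E‖E[W | X + W]‖² / (2t²), that is,
-- d/dγ h(X + W) = -E‖E[W | X + W]‖² / 2. It comes from integrating by parts against the heat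
-- equation; Bayes' formula (`condExp_noise_ae_eq`) then reads the Fisher information as an
-- estimation quantity.
--
-- Let G(γ) be the entropy of the noisy mixture minus the weighted entropies of the noisy
-- components. The mixed noise is again Gaussian with variance t, so G' is half of a weighted
-- difference of noise energies. By independence and centring, the weighted component energies add
-- up to E‖E[W | Y₁, Y₂]‖² for the mixed noise W. Pythagoras for nested conditional expectations
-- turns the difference into E‖E[W | Y] - E[W | Y₁, Y₂]‖², and since X + W is observed, replacing W
-- by X only changes signs (`GaussianChannels.estimationGap_eq`).
--
-- It remains to find the end values of G. As γ → 0, every noisy entropy approaches that of the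
-- noise, and the weights sum to 1, so G → 0. As γ → ∞, the noisy entropies tend to the original
-- ones in [-∞, ∞) (`tendsto_noisyEntropy`): Fatou's lemma for the relative entropy with respect to
-- a Gaussian gives one half, monotonicity of entropy under convolution the other. Hence G tends to
-- the deficit, and the identity at each finite γ passes to the limit wherever addition of extended
-- reals is continuous. In the excluded case the lower bound is -∞, so the inequality is trivial.

open Filter Topology

noncomputable section

-- The Gaussian heat kernel: normalisation, domination and shears.

namespace EPI

variable {n : ℕ}

/-- The density of the centred Gaussian law on `ℝⁿ` with covariance `t • 1`. -/
def heatKernel (t : ℝ) (v : Vec n) : ℝ :=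
  Real.exp (-(n / 2 * Real.log (2 * Real.pi * t)) - ‖v‖ ^ 2 / (2 * t))

lemma heatKernel_pos (t : ℝ) (v : Vec n) : 0 < heatKernel t v := Real.exp_pos _

lemma heatKernel_neg (t : ℝ) (v : Vec n) : heatKernel t (-v) = heatKernel t v := by
  simp [heatKernel]

lemma log_heatKernel (t : ℝ) (v : Vec n) :
    Real.log (heatKernel t v) = -(n / 2 * Real.log (2 * Real.pi * t)) - ‖v‖ ^ 2 / (2 * t) :=
  Real.log_exp _

@[fun_prop]
lemma continuous_heatKernel (t : ℝ) : Continuous (heatKernel t : Vec n → ℝ) := by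
  unfold heatKernel
  fun_prop

lemma heatKernel_eq {t : ℝ} (ht : 0 < t) (v : Vec n) :
    heatKernel t v = (2 * Real.pi * t) ^ (-(n / 2 : ℝ)) * Real.exp (-(1 / (2 * t)) * ‖v‖ ^ 2) := by
  rw [Real.rpow_def_of_pos (by positivity), ← Real.exp_add, heatKernel]
  congr 1
  ring

lemma integrable_exp_neg_mul_sq {c : ℝ} (hc : 0 < c) :
    Integrable (fun v : Vec n => Real.exp (-c * ‖v‖ ^ 2)) := by
  have h := (GaussianFourier.integrable_cexp_neg_mul_sq_norm_add (b := (c : ℂ)) (V := Vec n)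
    (by simpa using hc) 0 0).norm
  refine h.congr (ae_of_all _ fun v => ?_)
  simp only [Complex.norm_exp]
  congr 1
  rw [zero_mul, add_zero, ← Complex.ofReal_neg, ← Complex.ofReal_pow, ← Complex.ofReal_mul,
    Complex.ofReal_re]

lemma integrable_heatKernel {t : ℝ} (ht : 0 < t) : Integrable (heatKernel t : Vec n → ℝ) := by
  have : (heatKernel t : Vec n → ℝ) = _ := funext (heatKernel_eq ht)
  rw [this]
  exact (integrable_exp_neg_mul_sq (by positivity)).const_mul _

lemma integral_heatKernel {t : ℝ} (ht : 0 < t) : ∫ v : Vec n, heatKernel t v = 1 := by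
  simp_rw [heatKernel_eq ht]
  rw [integral_const_mul, GaussianFourier.integral_rexp_neg_mul_sq_norm (by positivity),
    finrank_euclideanSpace_fin, show Real.pi / (1 / (2 * t)) = 2 * Real.pi * t by field_simp,
    ← Real.rpow_add (by positivity)]
  simp

lemma lintegral_heatKernel {t : ℝ} (ht : 0 < t) :
    ∫⁻ v : Vec n, ENNReal.ofReal (heatKernel t v) = 1 := by
  rw [← ofReal_integral_eq_lintegral_ofReal (integrable_heatKernel ht)
    (ae_of_all _ fun v => (heatKernel_pos t v).le), integral_heatKernel ht, ENNReal.ofReal_one]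

/-- The centred Gaussian law on `ℝⁿ` with covariance `t • 1`. -/
def heatMeasure (t : ℝ) : Measure (Vec n) :=
  volume.withDensity fun v => ENNReal.ofReal (heatKernel t v)

lemma isProbabilityMeasure_heatMeasure {t : ℝ} (ht : 0 < t) :
    IsProbabilityMeasure (heatMeasure t : Measure (Vec n)) :=
  ⟨by rw [heatMeasure, withDensity_apply _ .univ, setLIntegral_univ, lintegral_heatKernel ht]⟩

lemma integral_heatMeasure {E : Type*} [NormedAddCommGroup E] [NormedSpace ℝ E] (t : ℝ)
    (F : Vec n → E) : ∫ v, F v ∂(heatMeasure t) = ∫ v, heatKernel t v • F v := by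
  rw [heatMeasure, integral_withDensity_eq_integral_toReal_smul (by fun_prop) (by simp)]
  simp [ENNReal.toReal_ofReal (heatKernel_pos t _).le]

/-- The two characteristic functions agree: that of the explicit density is a Gaussian Fourier
integral whose power of 2πt cancels the normalisation. -/
lemma map_smul_stdGaussian {t : ℝ} (ht : 0 < t) :
    (stdGaussian (Vec n)).map (fun z => √t • z) = heatMeasure t := by
  have := isProbabilityMeasure_heatMeasure (n := n) ht
  have : IsProbabilityMeasure ((stdGaussian (Vec n)).map (fun z => √t • z)) :=
    Measure.isProbabilityMeasure_map (by fun_prop)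
  refine Measure.ext_of_charFun (funext fun s => ?_)
  rw [charFun_map_smul, charFun_stdGaussian, charFun_apply, integral_heatMeasure]
  have key := GaussianFourier.integral_cexp_neg_mul_sq_norm_add (V := Vec n)
    (b := ((1 / (2 * t) : ℝ) : ℂ)) (by rw [Complex.ofReal_re]; positivity) Complex.I s
  have e : ∀ v : Vec n, heatKernel t v • Complex.exp (inner ℝ v s * Complex.I)
      = (((2 * Real.pi * t) ^ (-(n / 2 : ℝ)) : ℝ) : ℂ) *
        Complex.exp (-((1 / (2 * t) : ℝ) : ℂ) * ‖v‖ ^ 2 + Complex.I * (inner ℝ s v)) := by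
    intro v
    rw [heatKernel_eq ht, Complex.exp_add, Complex.real_smul, real_inner_comm v s]
    push_cast
    rw [mul_comm Complex.I]
    ring
  simp_rw [e]
  rw [integral_const_mul, key, finrank_euclideanSpace_fin]
  have h1 : ((Real.pi : ℂ) / ((1 / (2 * t) : ℝ) : ℂ)) ^ ((n : ℂ) / 2)
      = (((2 * Real.pi * t) ^ (n / 2 : ℝ) : ℝ) : ℂ) := by
    rw [Complex.ofReal_cpow (by positivity), ← Complex.ofReal_div]
    congr 2
    · field_simp
    · push_cast; rfl
  rw [h1, ← mul_assoc, ← Complex.ofReal_mul, ← Real.rpow_add (by positivity)]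
  simp only [neg_add_cancel, Real.rpow_zero, Complex.ofReal_one, one_mul, Complex.I_sq]
  congr 1
  rw [norm_smul, Real.norm_of_nonneg (Real.sqrt_nonneg t)]
  have ht' : (t : ℂ) ≠ 0 := by exact_mod_cast ht.ne'
  have h2 : ((√t : ℝ) : ℂ) ^ 2 = t := by exact_mod_cast Real.sq_sqrt ht.le
  push_cast
  rw [mul_pow, h2]
  field_simp
  ring

/-- A polynomial times a Gaussian is dominated by a wider Gaussian. -/
lemma exists_poly_mul_exp_le (j : ℕ) {a c : ℝ} (hc : c < a) :
    ∃ C : ℝ, 0 < C ∧ ∀ r : ℝ, 0 ≤ r → (1 + r) ^ j * Real.exp (-a * r) ≤ C * Real.exp (-c * r) := by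
  have hd : 0 < a - c := sub_pos.2 hc
  -- The constant comes from x ^ j / j! ≤ exp x at x = (a - c)(1 + r).
  refine ⟨j.factorial / (a - c) ^ j * Real.exp (a - c), by positivity, fun r hr => ?_⟩
  have h := Real.pow_div_factorial_le_exp ((a - c) * (1 + r)) (by positivity) j
  rw [div_le_iff₀ (by positivity), mul_pow] at h
  have h1 : (1 + r) ^ j ≤ j.factorial / (a - c) ^ j * Real.exp ((a - c) * (1 + r)) := by
    rw [div_mul_eq_mul_div, le_div_iff₀ (by positivity)]
    linarith
  calc (1 + r) ^ j * Real.exp (-a * r)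
      ≤ j.factorial / (a - c) ^ j * Real.exp ((a - c) * (1 + r)) * Real.exp (-a * r) := by gcongr
    _ = j.factorial / (a - c) ^ j * Real.exp (a - c) * Real.exp (-c * r) := by
        rw [mul_assoc, mul_assoc, ← Real.exp_add, ← Real.exp_add]
        ring_nf

/-- Polynomial multiples of the heat kernel, locally uniformly in time, are dominated by a single
Gaussian. -/
lemma exists_poly_mul_heatKernel_le (n j : ℕ) {a b : ℝ} (ha : 0 < a) (hab : a ≤ b) :
    ∃ C : ℝ, 0 < C ∧ ∀ t ∈ Icc a b, ∀ v : Vec n,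
      (1 + ‖v‖ ^ 2) ^ j * heatKernel t v ≤ C * Real.exp (-(1 / (4 * b)) * ‖v‖ ^ 2) := by
  have hb : 0 < b := ha.trans_le hab
  -- On [a, b] the decay rate is at least 1 / (2b) and the prefactor is largest at t = a; half of
  -- the rate is given up to absorb the polynomial.
  obtain ⟨C, hC, h⟩ := exists_poly_mul_exp_le j (a := 1 / (2 * b)) (c := 1 / (4 * b))
    (by gcongr; norm_num)
  refine ⟨C * Real.exp (-(n / 2 * Real.log (2 * Real.pi * a))), by positivity,
    fun t ht v => ?_⟩
  have ht0 : 0 < t := ha.trans_le ht.1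
  have hk : heatKernel t v ≤ Real.exp (-(n / 2 * Real.log (2 * Real.pi * a))) *
      Real.exp (-(1 / (2 * b)) * ‖v‖ ^ 2) := by
    rw [heatKernel, ← Real.exp_add]
    apply Real.exp_le_exp.2
    have h1 : Real.log (2 * Real.pi * a) ≤ Real.log (2 * Real.pi * t) := by
      apply Real.log_le_log (by positivity)
      have := ht.1
      gcongr
    have h2 : ‖v‖ ^ 2 / (2 * b) ≤ ‖v‖ ^ 2 / (2 * t) := by
      have := ht.2
      gcongr
    have h3 : (n / 2 : ℝ) * Real.log (2 * Real.pi * a) ≤ n / 2 * Real.log (2 * Real.pi * t) := by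
      gcongr
    have h4 : -(1 / (2 * b)) * ‖v‖ ^ 2 = -(‖v‖ ^ 2 / (2 * b)) := by ring
    linarith
  calc (1 + ‖v‖ ^ 2) ^ j * heatKernel t v
      ≤ (1 + ‖v‖ ^ 2) ^ j * (Real.exp (-(n / 2 * Real.log (2 * Real.pi * a))) *
        Real.exp (-(1 / (2 * b)) * ‖v‖ ^ 2)) := by gcongr
    _ = (1 + ‖v‖ ^ 2) ^ j * Real.exp (-(1 / (2 * b)) * ‖v‖ ^ 2) *
        Real.exp (-(n / 2 * Real.log (2 * Real.pi * a))) := by ring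
    _ ≤ C * Real.exp (-(1 / (4 * b)) * ‖v‖ ^ 2) *
        Real.exp (-(n / 2 * Real.log (2 * Real.pi * a))) := by
        exact mul_le_mul_of_nonneg_right (h _ (by positivity)) (Real.exp_pos _).le
    _ = _ := by ring

lemma integrable_poly_mul_heatKernel (j : ℕ) {t : ℝ} (ht : 0 < t) :
    Integrable (fun v : Vec n => (1 + ‖v‖ ^ 2) ^ j * heatKernel t v) := by
  obtain ⟨C, -, h⟩ := exists_poly_mul_heatKernel_le n j ht le_rfl
  refine Integrable.mono' ((integrable_exp_neg_mul_sq (n := n) (c := 1 / (4 * t))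
    (by positivity)).const_mul C) (by fun_prop) (ae_of_all _ fun v => ?_)
  have := heatKernel_pos t v
  rw [Real.norm_of_nonneg (by positivity)]
  exact h t ⟨le_rfl, le_rfl⟩ v

lemma integrable_poly_mul_exp (j : ℕ) {c : ℝ} (hc : 0 < c) :
    Integrable (fun v : Vec n => (1 + ‖v‖ ^ 2) ^ j * Real.exp (-c * ‖v‖ ^ 2)) := by
  obtain ⟨C, -, h⟩ := exists_poly_mul_exp_le j (half_lt_self hc)
  refine Integrable.mono' ((integrable_exp_neg_mul_sq (n := n) (half_pos hc)).const_mul C)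
    (by fun_prop) (ae_of_all _ fun v => ?_)
  rw [Real.norm_of_nonneg (by positivity)]
  exact h _ (by positivity)

/-- The shear `(x, v) ↦ (x, x + v)` preserves the product of a measure with Lebesgue measure. -/
lemma measurePreserving_shear (μ : Measure (Vec n)) [SFinite μ] :
    MeasurePreserving (fun z : Vec n × Vec n => (z.1, z.1 + z.2)) (μ.prod volume)
      (μ.prod volume) :=
  measurePreserving_prod_add μ volume

lemma measurableEmbedding_shear :
    MeasurableEmbedding (fun z : Vec n × Vec n => (z.1, z.1 + z.2)) :=
  (Homeomorph.shearAddRight (Vec n)).measurableEmbedding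

lemma integral_shear {E : Type*} [NormedAddCommGroup E] [NormedSpace ℝ E] (μ : Measure (Vec n))
    [SFinite μ] (F : Vec n × Vec n → E) :
    ∫ z, F (z.1, z.1 + z.2) ∂(μ.prod volume) = ∫ z, F z ∂(μ.prod volume) :=
  (measurePreserving_shear μ).integral_comp measurableEmbedding_shear F

lemma integrable_shear_iff {E : Type*} [NormedAddCommGroup E] [NormedSpace ℝ E]
    (μ : Measure (Vec n)) [SFinite μ] (F : Vec n × Vec n → E) :
    Integrable (fun z => F (z.1, z.1 + z.2)) (μ.prod volume) ↔ Integrable F (μ.prod volume) :=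
  (measurePreserving_shear μ).integrable_comp_emb measurableEmbedding_shear

end EPI

-- Convolutions of a probability measure with rapidly decaying kernels.

namespace EPI

variable {n : ℕ}

/-- A continuous kernel dominated by a Gaussian. -/
structure GaussianDecay (k : Vec n → ℝ) : Prop where
  continuous : Continuous k
  exists_bound : ∃ c : ℝ, 0 < c ∧ ∃ C : ℝ, ∀ v, |k v| ≤ C * Real.exp (-c * ‖v‖ ^ 2)

namespace GaussianDecay

variable {k : Vec n → ℝ}

lemma exists_abs_le (hk : GaussianDecay k) : ∃ C : ℝ, ∀ v, |k v| ≤ C := by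
  obtain ⟨c, hc, C, h⟩ := hk.exists_bound
  have hC : 0 ≤ C := by
    have := (abs_nonneg _).trans (h 0)
    simpa using this
  refine ⟨C, fun v => (h v).trans (mul_le_of_le_one_right hC (Real.exp_le_one_iff.2 ?_))⟩
  have : 0 ≤ c * ‖v‖ ^ 2 := by positivity
  linarith

lemma of_le {C : ℝ} (hk : Continuous k) (j : ℕ) {t : ℝ} (ht : 0 < t)
    (h : ∀ v, |k v| ≤ C * ((1 + ‖v‖ ^ 2) ^ j * heatKernel t v)) : GaussianDecay k := by
  obtain ⟨D, hD, h'⟩ := exists_poly_mul_heatKernel_le n j ht le_rfl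
  have hC : 0 ≤ C := by
    have := (abs_nonneg _).trans (h 0)
    have h0 := heatKernel_pos t (0 : Vec n)
    simp only [norm_zero] at this
    norm_num at this
    exact nonneg_of_mul_nonneg_left this h0
  refine ⟨hk, 1 / (4 * t), by positivity, C * D, fun v => (h v).trans ?_⟩
  rw [mul_assoc]
  exact mul_le_mul_of_nonneg_left (h' t ⟨le_rfl, le_rfl⟩ v) hC

end GaussianDecay

/-- The convolution `y ↦ ∫ k(y - x) dμ(x)` of a kernel with a measure. -/
def smooth (μ : Measure (Vec n)) (k : Vec n → ℝ) (y : Vec n) : ℝ := ∫ x, k (y - x) ∂μ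

section Smooth

variable (μ : Measure (Vec n)) [IsProbabilityMeasure μ]

lemma GaussianDecay.integrable_sub {k : Vec n → ℝ} (hk : GaussianDecay k) (y : Vec n) :
    Integrable (fun x => k (y - x)) μ := by
  obtain ⟨C, h⟩ := hk.exists_abs_le
  have := hk.continuous
  exact Integrable.mono' (integrable_const C) (by fun_prop) (ae_of_all _ fun x => h _)

lemma continuous_smooth {k : Vec n → ℝ} (hk : GaussianDecay k) : Continuous (smooth μ k) := by
  obtain ⟨C, h⟩ := hk.exists_abs_le
  have := hk.continuous
  exact continuous_of_dominated (F := fun y x => k (y - x)) (bound := fun _ => C)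
    (fun y => by fun_prop) (fun y => ae_of_all _ fun x => h _) (integrable_const C)
    (ae_of_all _ fun x => by fun_prop)

lemma hasLineDerivAt_smooth {k k' : Vec n → ℝ} {e : Vec n} (hk : GaussianDecay k)
    (hk' : GaussianDecay k') (h : ∀ v, HasLineDerivAt ℝ k (k' v) v e) (y : Vec n) :
    HasLineDerivAt ℝ (smooth μ k) (smooth μ k' y) y e := by
  obtain ⟨C, hC⟩ := hk'.exists_abs_le
  have h1 := hk.continuous
  have h2 := hk'.continuous
  have key := (hasDerivAt_integral_of_dominated_loc_of_deriv_le (μ := μ) (𝕜 := ℝ)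
    (F := fun s x => k (y + s • e - x)) (F' := fun s x => k' (y + s • e - x)) (x₀ := 0)
    (s := univ) (bound := fun _ => C) univ_mem (Eventually.of_forall fun s => by fun_prop)
    (hk.integrable_sub μ _) (by fun_prop) (ae_of_all _ fun x s _ => hC _) (integrable_const C)
    (ae_of_all _ fun x s _ => ?_)).2
  · simpa [HasLineDerivAt, smooth] using key
  · have := h (y + s • e - x)
    unfold HasLineDerivAt at this
    -- A line derivative is a derivative at parameter 0; shifting the parameter by s moves the base
    -- point along the line.
    have h3 : HasDerivAt (fun r : ℝ => r - s) 1 s := (hasDerivAt_id s).sub_const s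
    have h4 := HasDerivAt.comp_of_eq (h₂ := fun t => k (y + s • e - x + t • e)) s this h3
      (by simp)
    rw [mul_one] at h4
    refine h4.congr_of_eventuallyEq (Eventually.of_forall fun r => ?_)
    simp only [Function.comp_apply, sub_smul]
    congr 1
    abel

lemma hasDerivAt_smooth {k k' : ℝ → Vec n → ℝ} {t C : ℝ} {s : Set ℝ} (hs : s ∈ 𝓝 t)
    (hk : ∀ r ∈ s, GaussianDecay (k r)) (hk' : Continuous (k' t))
    (hC : ∀ r ∈ s, ∀ v, |k' r v| ≤ C)
    (h : ∀ r ∈ s, ∀ v, HasDerivAt (fun r => k r v) (k' r v) r) (y : Vec n) :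
    HasDerivAt (fun r => smooth μ (k r) y) (smooth μ (k' t) y) t :=
  (hasDerivAt_integral_of_dominated_loc_of_deriv_le (μ := μ) (𝕜 := ℝ)
    (F := fun r x => k r (y - x)) (F' := fun r x => k' r (y - x)) (x₀ := t)
    (s := s) (bound := fun _ => C) hs
    (by filter_upwards [hs] with r hr using ((hk r hr).integrable_sub μ y).1)
    ((hk t (mem_of_mem_nhds hs)).integrable_sub μ _) (by fun_prop)
    (ae_of_all _ fun x r hr => hC r hr _) (integrable_const C)
    (ae_of_all _ fun x r hr => h r hr _)).2

variable {μ}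

/-- The shear turns the integrand into A(x + v) k(v), and 1 + ‖x + v‖² ≤ 2 (1 + ‖x‖²)(1 + ‖v‖²)
separates the variables. Quadratic growth is what is needed for the logarithm of a noisy density. -/
lemma integrable_mul_kernel_prod (hμ : Integrable (fun x => ‖x‖ ^ 2) μ) {k A : Vec n → ℝ}
    (hk : GaussianDecay k) (hA : Measurable A) {B : ℝ} (hB : ∀ y, |A y| ≤ B * (1 + ‖y‖ ^ 2)) :
    Integrable (fun z : Vec n × Vec n => A z.2 * k (z.2 - z.1)) (μ.prod volume) := by
  rw [← integrable_shear_iff]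
  obtain ⟨c, hc, C, h⟩ := hk.exists_bound
  have h0 := hk.continuous
  have hi := ((integrable_const (1 : ℝ)).add hμ).mul_prod
    (integrable_poly_mul_exp (n := n) 1 hc)
  have hB0 : 0 ≤ B := by
    have := (abs_nonneg _).trans (hB 0)
    simpa using this
  have hm : AEStronglyMeasurable (fun z : Vec n × Vec n => A (z.1 + z.2) * k (z.1 + z.2 - z.1))
      (μ.prod volume) :=
    ((hA.comp (measurable_fst.add measurable_snd)).mul (h0.measurable.comp
      ((measurable_fst.add measurable_snd).sub measurable_fst))).aestronglyMeasurable
  refine Integrable.mono' (hi.const_mul (2 * B * C)) hm (ae_of_all _ fun z => ?_)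
  simp only [add_sub_cancel_left, Pi.add_apply, pow_one, Real.norm_eq_abs, abs_mul]
  have h1 : 1 + ‖z.1 + z.2‖ ^ 2 ≤ 2 * ((1 + ‖z.1‖ ^ 2) * (1 + ‖z.2‖ ^ 2)) := by
    have := norm_add_le z.1 z.2
    have h3 : ‖z.1 + z.2‖ ^ 2 ≤ (‖z.1‖ + ‖z.2‖) ^ 2 := by gcongr
    nlinarith [sq_nonneg (‖z.1‖ - ‖z.2‖), mul_nonneg (sq_nonneg ‖z.1‖) (sq_nonneg ‖z.2‖)]
  calc |A (z.1 + z.2)| * |k z.2|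
      ≤ (B * (2 * ((1 + ‖z.1‖ ^ 2) * (1 + ‖z.2‖ ^ 2)))) * (C * Real.exp (-c * ‖z.2‖ ^ 2)) := by
        gcongr
        · exact (hB _).trans (by gcongr)
        · exact h _
    _ = _ := by ring

lemma integrable_mul_smooth (hμ : Integrable (fun x => ‖x‖ ^ 2) μ) {k A : Vec n → ℝ}
    (hk : GaussianDecay k) (hA : Measurable A) {B : ℝ} (hB : ∀ y, |A y| ≤ B * (1 + ‖y‖ ^ 2)) :
    Integrable (fun y => A y * smooth μ k y) := by
  refine (integrable_mul_kernel_prod hμ hk hA hB).integral_prod_right.congr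
    (ae_of_all _ fun y => ?_)
  simp [smooth, integral_const_mul]

lemma integrable_smooth (hμ : Integrable (fun x => ‖x‖ ^ 2) μ) {k : Vec n → ℝ}
    (hk : GaussianDecay k) : Integrable (smooth μ k) := by
  simpa using integrable_mul_smooth hμ hk (A := fun _ => 1) measurable_const (B := 1)
    (fun y => by simp)

end Smooth

/-! ### Derivatives of the heat kernel -/

/-- The kernel `⟨v, e⟩ g_t(v)`. -/
def scoreKernel (t : ℝ) (e v : Vec n) : ℝ := inner ℝ v e * heatKernel t v

/-- The kernel `⟨v, e⟩² g_t(v)`. -/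
def sqKernel (t : ℝ) (e v : Vec n) : ℝ := inner ℝ v e ^ 2 * heatKernel t v

/-- The derivative of `scoreKernel t e` in the direction `e`. -/
def hessKernel (t : ℝ) (e v : Vec n) : ℝ := (‖e‖ ^ 2 - inner ℝ v e ^ 2 / t) * heatKernel t v

/-- The time derivative of the heat kernel. -/
def timeKernel (t : ℝ) (v : Vec n) : ℝ := (‖v‖ ^ 2 / (2 * t ^ 2) - n / (2 * t)) * heatKernel t v

lemma hasLineDerivAt_heatKernel {t : ℝ} (ht : 0 < t) (e v : Vec n) :
    HasLineDerivAt ℝ (heatKernel t) (-(1 / t) * scoreKernel t e v) v e := by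
  unfold HasLineDerivAt
  have h1 : HasDerivAt (fun s : ℝ => v + s • e) e 0 := by
    simpa using ((hasDerivAt_id (0 : ℝ)).smul_const e).const_add v
  have h2 := ((h1.norm_sq.div_const (2 * t)).const_sub
    (-(n / 2 * Real.log (2 * Real.pi * t)))).exp
  refine h2.congr_deriv ?_
  simp only [zero_smul, add_zero, scoreKernel, heatKernel]
  field_simp

lemma hasLineDerivAt_scoreKernel {t : ℝ} (ht : 0 < t) (e v : Vec n) :
    HasLineDerivAt ℝ (scoreKernel t e) (hessKernel t e v) v e := by
  have h1 := hasLineDerivAt_heatKernel ht e v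
  unfold HasLineDerivAt at h1 ⊢
  have h2 : HasDerivAt (fun s : ℝ => inner ℝ (v + s • e) e) (‖e‖ ^ 2) 0 := by
    have : HasDerivAt (fun s : ℝ => inner ℝ v e + s * ‖e‖ ^ 2) (‖e‖ ^ 2) 0 := by
      simpa using ((hasDerivAt_id (0 : ℝ)).mul_const (‖e‖ ^ 2)).const_add (inner ℝ v e)
    refine this.congr_of_eventuallyEq (Eventually.of_forall fun s => ?_)
    simp [inner_add_left, inner_smul_left]
  refine (h2.mul h1).congr_deriv ?_
  simp only [zero_smul, add_zero, scoreKernel, hessKernel]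
  ring

lemma hasDerivAt_heatKernel {t : ℝ} (ht : 0 < t) (v : Vec n) :
    HasDerivAt (fun r => heatKernel r v) (timeKernel t v) t := by
  have h1 : HasDerivAt (fun r => 2 * Real.pi * r) (2 * Real.pi) t := by
    simpa using (hasDerivAt_id t).const_mul (2 * Real.pi)
  have h2 := ((h1.log (by positivity)).const_mul (n / 2 : ℝ)).neg
  have h3 : HasDerivAt (fun r : ℝ => ‖v‖ ^ 2 / (2 * r)) (-(‖v‖ ^ 2 / (2 * t ^ 2))) t := by
    have := (hasDerivAt_inv ht.ne').const_mul (‖v‖ ^ 2 / 2)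
    refine (this.congr_of_eventuallyEq (Eventually.of_forall fun r => ?_)).congr_deriv ?_
    · simp only [div_eq_mul_inv, mul_inv]
      ring
    · field_simp
  refine (h2.sub h3).exp.congr_deriv ?_
  simp only [timeKernel, heatKernel, Pi.neg_apply, Pi.sub_apply]
  field_simp
  ring

/-- This is the heat equation ∂ₜg = ½ Δg: the score kernel is -t times the directional derivative of
g, so the sum is -t Δg. -/
lemma sum_hessKernel {t : ℝ} (ht : 0 < t) (v : Vec n) :
    ∑ i, hessKernel t (EuclideanSpace.single i (1 : ℝ)) v = -(2 * t) * timeKernel t v := by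
  simp only [hessKernel, timeKernel, EuclideanSpace.inner_single_right, PiLp.norm_single,
    one_mul, conj_trivial, norm_one, one_pow]
  rw [← Finset.sum_mul, Finset.sum_sub_distrib, ← Finset.sum_div, EuclideanSpace.norm_sq_eq]
  simp only [Finset.sum_const, Finset.card_univ, Fintype.card_fin, Real.norm_eq_abs, sq_abs,
    nsmul_eq_mul, mul_one]
  field_simp
  ring

lemma gaussianDecay_heatKernel {t : ℝ} (ht : 0 < t) :
    GaussianDecay (heatKernel t : Vec n → ℝ) :=
  .of_le (C := 1) (by fun_prop) 0 ht fun v => by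
    rw [abs_of_pos (heatKernel_pos t v)]
    simp

lemma inner_sq_le (e v : Vec n) : inner ℝ v e ^ 2 ≤ ‖e‖ ^ 2 * (1 + ‖v‖ ^ 2) := by
  have h := abs_real_inner_le_norm v e
  have h2 : inner ℝ v e ^ 2 ≤ (‖v‖ * ‖e‖) ^ 2 := by
    rw [← sq_abs]
    gcongr
  nlinarith [sq_nonneg ‖e‖]

lemma gaussianDecay_sqKernel {t : ℝ} (ht : 0 < t) (e : Vec n) :
    GaussianDecay (sqKernel t e) :=
  .of_le (C := ‖e‖ ^ 2) (by unfold sqKernel; fun_prop) 1 ht fun v => by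
    have h0 := heatKernel_pos t v
    rw [sqKernel, abs_of_nonneg (by positivity), ← mul_assoc, pow_one]
    gcongr
    exact inner_sq_le e v

lemma gaussianDecay_scoreKernel {t : ℝ} (ht : 0 < t) (e : Vec n) :
    GaussianDecay (scoreKernel t e) :=
  .of_le (C := 1 + ‖e‖ ^ 2) (by unfold scoreKernel; fun_prop) 1 ht fun v => by
    have h0 := heatKernel_pos t v
    rw [scoreKernel, abs_mul, abs_of_pos h0, ← mul_assoc, pow_one]
    gcongr
    have h1 := inner_sq_le e v
    rw [← sq_abs] at h1
    nlinarith [sq_nonneg (|inner ℝ v e| - 1), sq_nonneg ‖v‖]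

lemma gaussianDecay_hessKernel {t : ℝ} (ht : 0 < t) (e : Vec n) :
    GaussianDecay (hessKernel t e) :=
  .of_le (C := ‖e‖ ^ 2 * (1 + 1 / t)) (by unfold hessKernel; fun_prop) 1 ht fun v => by
    have h0 := heatKernel_pos t v
    rw [hessKernel, abs_mul, abs_of_pos h0, ← mul_assoc, pow_one]
    gcongr
    have h1 := inner_sq_le e v
    have h2 : inner ℝ v e ^ 2 / t ≤ ‖e‖ ^ 2 * (1 + ‖v‖ ^ 2) / t := by gcongr
    have h3 : 0 ≤ inner ℝ v e ^ 2 / t := by positivity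
    have h4 : 0 ≤ ‖e‖ ^ 2 * ‖v‖ ^ 2 := by positivity
    have h5 : ‖e‖ ^ 2 * (1 + 1 / t) * (1 + ‖v‖ ^ 2)
      = ‖e‖ ^ 2 + ‖e‖ ^ 2 * ‖v‖ ^ 2 + ‖e‖ ^ 2 * (1 + ‖v‖ ^ 2) / t := by ring
    rw [h5, abs_le]
    constructor <;> nlinarith [sq_nonneg ‖e‖]

lemma abs_timeKernel_le {a b t : ℝ} (ha : 0 < a) (ht : t ∈ Icc a b) (v : Vec n) :
    |timeKernel t v| ≤ (1 / (2 * a ^ 2) + n / (2 * a)) *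
      ((1 + ‖v‖ ^ 2) ^ 1 * heatKernel t v) := by
  have h0 := heatKernel_pos t v
  have hat := ht.1
  have ht0 : 0 < t := ha.trans_le ht.1
  rw [timeKernel, abs_mul, abs_of_pos h0, ← mul_assoc, pow_one]
  gcongr
  have h1 : ‖v‖ ^ 2 / (2 * t ^ 2) ≤ ‖v‖ ^ 2 / (2 * a ^ 2) := by gcongr
  have h2 : (n : ℝ) / (2 * t) ≤ n / (2 * a) := by gcongr
  have h3 : 0 ≤ ‖v‖ ^ 2 / (2 * t ^ 2) := by positivity
  have h4 : 0 ≤ (n : ℝ) / (2 * t) := by positivity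
  have h5 : (1 / (2 * a ^ 2) + n / (2 * a)) * (1 + ‖v‖ ^ 2)
    = ‖v‖ ^ 2 / (2 * a ^ 2) + n / (2 * a) + (1 / (2 * a ^ 2) + n / (2 * a) * ‖v‖ ^ 2) := by ring
  have h6 : 0 ≤ 1 / (2 * a ^ 2) + n / (2 * a) * ‖v‖ ^ 2 := by positivity
  rw [h5, abs_le]
  constructor <;> linarith

/-! ### The density of `X + √t Z` -/

/-- The density at time `t` of the heat flow started at `μ`. -/
def noisy (μ : Measure (Vec n)) (t : ℝ) : Vec n → ℝ := smooth μ (heatKernel t)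

section Noisy

variable {μ : Measure (Vec n)} [IsProbabilityMeasure μ]

lemma continuous_noisy {t : ℝ} (ht : 0 < t) : Continuous (noisy μ t) :=
  continuous_smooth μ (gaussianDecay_heatKernel ht)

/-- Jensen's inequality by hand: bound ‖y - x‖² by 2‖y‖² + 2‖x‖², then replace the exponential by
its tangent at the mean of ‖x‖², whose linear term integrates to zero. It makes the noisy density
positive with a logarithm of at most quadratic growth. -/
lemma le_noisy (hμ : Integrable (fun x => ‖x‖ ^ 2) μ) {t : ℝ} (ht : 0 < t) (y : Vec n) :
    Real.exp (-(n / 2 * Real.log (2 * Real.pi * t)) - (‖y‖ ^ 2 + ∫ x, ‖x‖ ^ 2 ∂μ) / t)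
      ≤ noisy μ t y := by
  set L := (n : ℝ) / 2 * Real.log (2 * Real.pi * t) with hL
  set V := ∫ x, ‖x‖ ^ 2 ∂μ with hV
  set m := -L - (‖y‖ ^ 2 + V) / t with hm
  have hi0 : Integrable (fun x => (V - ‖x‖ ^ 2) / t) μ :=
    ((integrable_const V).sub hμ).div_const t
  have hi : Integrable (fun x => Real.exp m * (1 + (V - ‖x‖ ^ 2) / t)) μ :=
    ((integrable_const (1 : ℝ)).add hi0).const_mul _
  have h1 : ∫ x, Real.exp m * (1 + (V - ‖x‖ ^ 2) / t) ∂μ = Real.exp m := by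
    rw [integral_const_mul, integral_add (integrable_const _) hi0, integral_div, integral_sub (integrable_const _)
      hμ]
    simp [← hV]
  rw [← h1, noisy, smooth]
  refine integral_mono hi ((gaussianDecay_heatKernel ht).integrable_sub μ y) fun x => ?_
  have h2 : ‖y - x‖ ^ 2 ≤ 2 * (‖y‖ ^ 2 + ‖x‖ ^ 2) := by
    have := norm_sub_le y x
    have h3 : ‖y - x‖ ^ 2 ≤ (‖y‖ + ‖x‖) ^ 2 := by gcongr
    nlinarith [sq_nonneg (‖y‖ - ‖x‖)]
  have h4 : m + (V - ‖x‖ ^ 2) / t ≤ -L - ‖y - x‖ ^ 2 / (2 * t) := by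
    have : ‖y - x‖ ^ 2 / (2 * t) ≤ 2 * (‖y‖ ^ 2 + ‖x‖ ^ 2) / (2 * t) := by gcongr
    have e : 2 * (‖y‖ ^ 2 + ‖x‖ ^ 2) / (2 * t) = (‖y‖ ^ 2 + ‖x‖ ^ 2) / t := by field_simp
    rw [e] at this
    have e2 : m + (V - ‖x‖ ^ 2) / t = -L - (‖y‖ ^ 2 + ‖x‖ ^ 2) / t := by
      rw [hm]; ring
    linarith
  calc Real.exp m * (1 + (V - ‖x‖ ^ 2) / t)
      ≤ Real.exp m * Real.exp ((V - ‖x‖ ^ 2) / t) := by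
        gcongr
        rw [add_comm]
        exact Real.add_one_le_exp _
    _ = Real.exp (m + (V - ‖x‖ ^ 2) / t) := (Real.exp_add _ _).symm
    _ ≤ _ := Real.exp_le_exp.2 h4

lemma noisy_pos (hμ : Integrable (fun x => ‖x‖ ^ 2) μ) {t : ℝ} (ht : 0 < t) (y : Vec n) :
    0 < noisy μ t y := (Real.exp_pos _).trans_le (le_noisy hμ ht y)

lemma noisy_le {t : ℝ} (ht : 0 < t) (y : Vec n) :
    noisy μ t y ≤ Real.exp (-(n / 2 * Real.log (2 * Real.pi * t))) := by
  have h := integral_mono ((gaussianDecay_heatKernel ht).integrable_sub μ y)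
    (integrable_const (Real.exp (-(n / 2 * Real.log (2 * Real.pi * t))))) fun x => by
      apply Real.exp_le_exp.2
      have : 0 ≤ ‖y - x‖ ^ 2 / (2 * t) := by positivity
      linarith
  simpa [noisy, smooth] using h

lemma abs_log_noisy_le (hμ : Integrable (fun x => ‖x‖ ^ 2) μ) {t : ℝ} (ht : 0 < t) (y : Vec n) :
    |Real.log (noisy μ t y)| ≤
      n / 2 * |Real.log (2 * Real.pi * t)| + (‖y‖ ^ 2 + ∫ x, ‖x‖ ^ 2 ∂μ) / t := by
  have h1 := Real.log_le_log (Real.exp_pos _) (le_noisy hμ ht y)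
  have h2 := Real.log_le_log (noisy_pos hμ ht y) (noisy_le ht y)
  rw [Real.log_exp] at h1 h2
  have h3 : 0 ≤ (‖y‖ ^ 2 + ∫ x, ‖x‖ ^ 2 ∂μ) / t := by positivity
  have h4 := neg_abs_le (Real.log (2 * Real.pi * t))
  have h5 := le_abs_self (Real.log (2 * Real.pi * t))
  have hn : (0 : ℝ) ≤ n / 2 := by positivity
  have h6 := mul_le_mul_of_nonneg_left h4 hn
  have h7 := mul_le_mul_of_nonneg_left h5 hn
  rw [abs_le]
  constructor <;> linarith

/-- Uniformity in t over a compact interval is what allows differentiation of the entropy under the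
integral. -/
lemma exists_abs_log_noisy_le (hμ : Integrable (fun x => ‖x‖ ^ 2) μ) {a b : ℝ} (ha : 0 < a) :
    ∃ A : ℝ, ∀ t ∈ Icc a b, ∀ y, |Real.log (noisy μ t y)| ≤ A * (1 + ‖y‖ ^ 2) := by
  set V := ∫ x, ‖x‖ ^ 2 ∂μ
  have hV : 0 ≤ V := integral_nonneg fun x => by positivity
  set K := (n : ℝ) / 2 * (|Real.log (2 * Real.pi * a)| + |Real.log (2 * Real.pi * b)|)
  have hK : 0 ≤ K := by positivity
  refine ⟨K + (1 + V) / a, fun t ht y => (abs_log_noisy_le hμ (ha.trans_le ht.1) y).trans ?_⟩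
  have ht0 : 0 < t := ha.trans_le ht.1
  have h1 : |Real.log (2 * Real.pi * t)| ≤
      |Real.log (2 * Real.pi * a)| + |Real.log (2 * Real.pi * b)| := by
    have hl : Real.log (2 * Real.pi * a) ≤ Real.log (2 * Real.pi * t) :=
      Real.log_le_log (by positivity) (by have := ht.1; gcongr)
    have hr : Real.log (2 * Real.pi * t) ≤ Real.log (2 * Real.pi * b) :=
      Real.log_le_log (by positivity) (by have := ht.2; gcongr)
    have := neg_abs_le (Real.log (2 * Real.pi * a))
    have := le_abs_self (Real.log (2 * Real.pi * b))
    have := abs_nonneg (Real.log (2 * Real.pi * a))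
    have := abs_nonneg (Real.log (2 * Real.pi * b))
    rw [abs_le]
    constructor <;> linarith
  have h2 : (‖y‖ ^ 2 + V) / t ≤ (‖y‖ ^ 2 + V) / a := by
    have := ht.1
    gcongr
  have h3 : (‖y‖ ^ 2 + V) / a ≤ (1 + V) / a * (1 + ‖y‖ ^ 2) := by
    rw [div_mul_eq_mul_div]
    gcongr
    nlinarith [sq_nonneg ‖y‖, mul_nonneg hV (sq_nonneg ‖y‖)]
  have h4 : (n : ℝ) / 2 * |Real.log (2 * Real.pi * t)| ≤ K * (1 + ‖y‖ ^ 2) := by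
    have : (n : ℝ) / 2 * |Real.log (2 * Real.pi * t)| ≤ K :=
      mul_le_mul_of_nonneg_left h1 (by positivity)
    nlinarith [mul_nonneg hK (sq_nonneg ‖y‖)]
  linarith

lemma integrable_noisy (hμ : Integrable (fun x => ‖x‖ ^ 2) μ) {t : ℝ} (ht : 0 < t) :
    Integrable (noisy μ t) :=
  integrable_smooth hμ (gaussianDecay_heatKernel ht)

lemma integrable_log_noisy_mul_smooth (hμ : Integrable (fun x => ‖x‖ ^ 2) μ) {t : ℝ} (ht : 0 < t)
    {k : Vec n → ℝ} (hk : GaussianDecay k) :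
    Integrable (fun y => Real.log (noisy μ t y) * smooth μ k y) := by
  obtain ⟨A, hA⟩ := exists_abs_log_noisy_le hμ (b := t) ht
  exact integrable_mul_smooth hμ hk (Real.measurable_log.comp (continuous_noisy ht).measurable)
    (hA t ⟨le_rfl, le_rfl⟩)

lemma integrable_negMulLog_noisy (hμ : Integrable (fun x => ‖x‖ ^ 2) μ) {t : ℝ} (ht : 0 < t) :
    Integrable (fun y => Real.negMulLog (noisy μ t y)) := by
  refine (integrable_log_noisy_mul_smooth hμ ht (gaussianDecay_heatKernel ht)).neg.congr
    (ae_of_all _ fun y => ?_)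
  simp only [Real.negMulLog, noisy, Pi.neg_apply]
  ring

end Noisy

end EPI

-- De Bruijn's identity.

namespace EPI

variable {n : ℕ} {μ : Measure (Vec n)} [IsProbabilityMeasure μ]

/-- The differential entropy of the heat flow of `μ` at time `t`. -/
def noisyEntropy (μ : Measure (Vec n)) (t : ℝ) : ℝ := ∫ y, Real.negMulLog (noisy μ t y)

/-- The second moment of the conditional expectation of the noise given the noisy observation. -/
def noiseEnergy (μ : Measure (Vec n)) (t : ℝ) : ℝ :=
  ∑ i, ∫ y, smooth μ (scoreKernel t (EuclideanSpace.single i 1)) y ^ 2 / noisy μ t y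

/-- Cauchy–Schwarz: the variance of ⟨y - x, e⟩ under the weight g_t(y - x) dμ(x) is nonnegative. The
right side is integrable in y, which makes the Fisher information finite. -/
lemma sq_smooth_scoreKernel_div_le (hμ : Integrable (fun x => ‖x‖ ^ 2) μ) {t : ℝ} (ht : 0 < t)
    (e y : Vec n) :
    smooth μ (scoreKernel t e) y ^ 2 / noisy μ t y ≤ smooth μ (sqKernel t e) y := by
  have hp := noisy_pos hμ ht y
  set p := noisy μ t y with hpdef
  set S := smooth μ (scoreKernel t e) y with hS
  set Q := smooth μ (sqKernel t e) y with hQ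
  have i0 := (gaussianDecay_heatKernel ht).integrable_sub μ y
  have i1 := (gaussianDecay_scoreKernel ht e).integrable_sub μ y
  have i2 := (gaussianDecay_sqKernel ht e).integrable_sub μ y
  have key : 0 ≤ ∫ x, (inner ℝ (y - x) e - S / p) ^ 2 * heatKernel t (y - x) ∂μ :=
    integral_nonneg fun x => mul_nonneg (sq_nonneg _) (heatKernel_pos t _).le
  have e1 : ∀ x, (inner ℝ (y - x) e - S / p) ^ 2 * heatKernel t (y - x)
      = sqKernel t e (y - x) - 2 * (S / p) * scoreKernel t e (y - x)
        + (S / p) ^ 2 * heatKernel t (y - x) := fun x => by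
    simp only [sqKernel, scoreKernel]; ring
  simp_rw [e1] at key
  have i3 : Integrable (fun x => sqKernel t e (y - x) - 2 * (S / p) * scoreKernel t e (y - x)) μ :=
    i2.sub (i1.const_mul _)
  rw [integral_add i3 (i0.const_mul _), integral_sub i2 (i1.const_mul _),
    integral_const_mul, integral_const_mul] at key
  change 0 ≤ Q - 2 * (S / p) * S + (S / p) ^ 2 * p at key
  have e2 : Q - 2 * (S / p) * S + (S / p) ^ 2 * p = Q - S ^ 2 / p := by field_simp; ring
  linarith

lemma integrable_sq_smooth_scoreKernel_div (hμ : Integrable (fun x => ‖x‖ ^ 2) μ) {t : ℝ}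
    (ht : 0 < t) (e : Vec n) :
    Integrable (fun y => smooth μ (scoreKernel t e) y ^ 2 / noisy μ t y) := by
  have h1 := (continuous_smooth μ (gaussianDecay_scoreKernel ht e)).measurable
  have h2 := (continuous_noisy (μ := μ) ht).measurable
  refine Integrable.mono' (integrable_smooth hμ (gaussianDecay_sqKernel ht e))
    ((h1.pow_const 2).div h2).aestronglyMeasurable (ae_of_all _ fun y => ?_)
  have hp := noisy_pos hμ ht y
  rw [Real.norm_of_nonneg (by positivity)]
  exact sq_smooth_scoreKernel_div_le hμ ht e y

/-- Integration by parts in the direction e, moving the derivative off the smoothed score S onto log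
p, where it yields -S / (t p). No boundary term arises because all three products involved are
integrable. -/
lemma integral_log_noisy_add_one_mul_smooth_hessKernel (hμ : Integrable (fun x => ‖x‖ ^ 2) μ)
    {t : ℝ} (ht : 0 < t) (e : Vec n) :
    ∫ y, (Real.log (noisy μ t y) + 1) * smooth μ (hessKernel t e) y =
      1 / t * ∫ y, smooth μ (scoreKernel t e) y ^ 2 / noisy μ t y := by
  have hlog : ∀ y, HasLineDerivAt ℝ (fun y => Real.log (noisy μ t y) + 1)
      (-(1 / t) * smooth μ (scoreKernel t e) y / noisy μ t y) y e := fun y => by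
    have h0 : GaussianDecay (fun v => -(1 / t) * scoreKernel t e v) := by
      refine ⟨(gaussianDecay_scoreKernel ht e).continuous.const_mul _, ?_⟩
      obtain ⟨c, hc, C, h⟩ := (gaussianDecay_scoreKernel ht e).exists_bound
      refine ⟨c, hc, |-(1 / t)| * C, fun v => ?_⟩
      rw [abs_mul, mul_assoc]
      gcongr
      exact h v
    have h := hasLineDerivAt_smooth μ (gaussianDecay_heatKernel ht) h0
      (hasLineDerivAt_heatKernel ht e) y
    unfold HasLineDerivAt at h ⊢
    have h1 := (h.log (by simpa [noisy] using (noisy_pos hμ ht y).ne')).add_const 1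
    refine h1.congr_deriv ?_
    simp only [smooth, noisy, integral_const_mul, zero_smul, add_zero]
  have hS := hasLineDerivAt_smooth μ (gaussianDecay_scoreKernel ht e)
    (gaussianDecay_hessKernel ht e) (hasLineDerivAt_scoreKernel ht e)
  have e1 : ∀ y, -(1 / t) * smooth μ (scoreKernel t e) y / noisy μ t y *
      smooth μ (scoreKernel t e) y
      = -(1 / t) * (smooth μ (scoreKernel t e) y ^ 2 / noisy μ t y) := fun y => by ring
  have hint : ∀ {k : Vec n → ℝ}, GaussianDecay k →
      Integrable (fun y => (Real.log (noisy μ t y) + 1) * smooth μ k y) := fun hk => by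
    refine ((integrable_log_noisy_mul_smooth hμ ht hk).add (integrable_smooth hμ hk)).congr
      (ae_of_all _ fun y => ?_)
    simp only [Pi.add_apply]
    ring
  have key := integral_bilinear_hasLineDerivAt_right_eq_neg_left_of_integrable
    (μ := (volume : Measure (Vec n))) (B := ContinuousLinearMap.mul ℝ ℝ)
    (f := fun y => Real.log (noisy μ t y) + 1) (g := smooth μ (scoreKernel t e))
    (f' := fun y => -(1 / t) * smooth μ (scoreKernel t e) y / noisy μ t y)
    (g' := smooth μ (hessKernel t e)) (v := e)
    (by
      simp only [ContinuousLinearMap.mul_apply', e1]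
      exact (integrable_sq_smooth_scoreKernel_div hμ ht e).const_mul _)
    (hint (gaussianDecay_hessKernel ht e)) (hint (gaussianDecay_scoreKernel ht e))
    (fun y _ => hlog y) (fun y _ => hS y)
  simp only [ContinuousLinearMap.mul_apply', e1] at key
  rw [key, integral_const_mul]
  ring

lemma hasDerivAt_noisy {t : ℝ} (ht : 0 < t) (y : Vec n) :
    HasDerivAt (fun r => noisy μ r y) (smooth μ (timeKernel t) y) t := by
  obtain ⟨C, hC, h⟩ := exists_poly_mul_heatKernel_le n 1 (half_pos ht) (b := 2 * t) (by linarith)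
  refine hasDerivAt_smooth μ (s := Icc (t / 2) (2 * t))
    (C := (1 / (2 * (t / 2) ^ 2) + n / (2 * (t / 2))) * C)
    (Icc_mem_nhds (by linarith) (by linarith))
    (fun r hr => gaussianDecay_heatKernel (by linarith [hr.1]))
    (by unfold timeKernel; fun_prop) (fun r hr v => ?_)
    (fun r hr v => hasDerivAt_heatKernel (by linarith [hr.1]) v) y
  refine (abs_timeKernel_le (half_pos ht) hr v).trans ?_
  gcongr
  refine (h r hr v).trans (mul_le_of_le_one_right hC.le (Real.exp_le_one_iff.2 ?_))
  have : 0 ≤ 1 / (4 * (2 * t)) * ‖v‖ ^ 2 := by positivity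
  linarith

/-- **De Bruijn's identity**: along the heat flow the entropy grows at the rate `½ J`, where the
Fisher information `J` is expressed by the energy of the conditional mean of the noise. -/
theorem hasDerivAt_noisyEntropy (hμ : Integrable (fun x => ‖x‖ ^ 2) μ) {t : ℝ} (ht : 0 < t) :
    HasDerivAt (noisyEntropy μ) (noiseEnergy μ t / (2 * t ^ 2)) t := by
  obtain ⟨C, hC, h⟩ := exists_poly_mul_heatKernel_le n 1 (half_pos ht) (b := 2 * t) (by linarith)
  obtain ⟨A, hA⟩ := exists_abs_log_noisy_le hμ (b := 2 * t) (half_pos ht)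
  set K := 1 / (2 * (t / 2) ^ 2) + n / (2 * (t / 2)) with hK
  set c := 1 / (4 * (2 * t)) with hc
  have hc0 : 0 < c := by positivity
  have hK0 : 0 ≤ K := by positivity
  have hg : GaussianDecay (fun v : Vec n => K * C * Real.exp (-c * ‖v‖ ^ 2)) :=
    ⟨by fun_prop, c, hc0, K * C, fun v => (abs_of_nonneg (by positivity)).le⟩
  have hA0 : 0 ≤ A := by
    have := (abs_nonneg _).trans (hA t ⟨by linarith, by linarith⟩ 0)
    simpa using this
  -- The majorant for times in [t/2, 2t]: the factor -log p - 1 grows at most quadratically, and the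
  -- time derivative of p is bounded by the convolution with one fixed Gaussian.
  have hbound := integrable_mul_smooth hμ hg (A := fun y => A * (1 + ‖y‖ ^ 2) + 1)
    (by fun_prop) (B := A + 1) fun y => by
      rw [abs_of_nonneg (by positivity)]
      nlinarith [sq_nonneg ‖y‖]
  have htime : ∀ r ∈ Icc (t / 2) (2 * t), ∀ y, |smooth μ (timeKernel r) y| ≤
      smooth μ (fun v => K * C * Real.exp (-c * ‖v‖ ^ 2)) y := fun r hr y => by
    refine (abs_integral_le_integral_abs).trans (integral_mono_of_nonneg
      (ae_of_all _ fun x => abs_nonneg _) (hg.integrable_sub μ y) (ae_of_all _ fun x => ?_))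
    refine (abs_timeKernel_le (half_pos ht) hr _).trans ?_
    change K * _ ≤ K * C * _
    rw [mul_assoc]
    exact mul_le_mul_of_nonneg_left (h r hr _) hK0
  have hpos : ∀ r ∈ Icc (t / 2) (2 * t), 0 < r := fun r hr => (half_pos ht).trans_le hr.1
  have hmem : Icc (t / 2) (2 * t) ∈ 𝓝 t := Icc_mem_nhds (by linarith) (by linarith)
  have htd : GaussianDecay (timeKernel t : Vec n → ℝ) :=
    .of_le (by unfold timeKernel; fun_prop) 1 ht
      (abs_timeKernel_le (b := t) ht ⟨le_rfl, le_rfl⟩)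
  have hmain := (hasDerivAt_integral_of_dominated_loc_of_deriv_le (𝕜 := ℝ)
    (μ := (volume : Measure (Vec n))) (F := fun r y => Real.negMulLog (noisy μ r y))
    (F' := fun r y => (-Real.log (noisy μ r y) - 1) * smooth μ (timeKernel r) y)
    (x₀ := t) (s := Icc (t / 2) (2 * t))
    (bound := fun y => (A * (1 + ‖y‖ ^ 2) + 1) *
      smooth μ (fun v => K * C * Real.exp (-c * ‖v‖ ^ 2)) y) hmem
    (by
      filter_upwards [hmem] with r hr
      exact (integrable_negMulLog_noisy hμ (hpos r hr)).1)
    (integrable_negMulLog_noisy hμ ht)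
    (by
      have h1 := (continuous_noisy (μ := μ) ht).measurable
      have h2 := (continuous_smooth μ htd).measurable
      fun_prop)
    (ae_of_all _ fun y r hr => by
      rw [Real.norm_eq_abs, abs_mul]
      refine mul_le_mul ?_ (htime r hr y) (abs_nonneg _) (by positivity)
      have h1 := abs_le.1 (hA r hr y)
      rw [abs_le]
      constructor <;> linarith)
    hbound
    (ae_of_all _ fun y r hr => by
      have h1 := noisy_pos hμ (hpos r hr) y
      exact (Real.hasDerivAt_negMulLog h1.ne').comp r (hasDerivAt_noisy (hpos r hr) y))).2
  refine hmain.congr_deriv ?_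
  -- The heat equation trades the time derivative for a sum of spatial ones, ready for integration
  -- by parts coordinate by coordinate.
  have e1 : ∀ y, (-Real.log (noisy μ t y) - 1) * smooth μ (timeKernel t) y
      = ∑ i, 1 / (2 * t) * ((Real.log (noisy μ t y) + 1) *
        smooth μ (hessKernel t (EuclideanSpace.single i 1)) y) := fun y => by
    have h1 : ∑ i, smooth μ (hessKernel t (EuclideanSpace.single i 1)) y
        = -(2 * t) * smooth μ (timeKernel t) y := by
      unfold smooth
      rw [← integral_finsetSum _ fun i _ => (gaussianDecay_hessKernel ht _).integrable_sub μ y,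
        ← integral_const_mul]
      simp_rw [sum_hessKernel ht]
    rw [← Finset.mul_sum, ← Finset.mul_sum, h1]
    field_simp
    ring
  simp_rw [e1]
  rw [integral_finsetSum, noiseEnergy, Finset.sum_div]
  · refine Finset.sum_congr rfl fun i _ => ?_
    rw [integral_const_mul, integral_log_noisy_add_one_mul_smooth_hessKernel hμ ht]
    field_simp
  · intro i _
    refine Integrable.const_mul ?_ _
    have hk := gaussianDecay_hessKernel ht (EuclideanSpace.single i (1 : ℝ))
    refine ((integrable_log_noisy_mul_smooth hμ ht hk).add (integrable_smooth hμ hk)).congr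
      (ae_of_all _ fun y => ?_)
    simp only [Pi.add_apply]
    ring

end EPI

-- The conditional mean of Gaussian noise.

namespace EPI

variable {n : ℕ}

/-- The conditional mean of the noise `√t Z` given the observation `X + √t Z = y`. -/
def noiseMean (μ : Measure (Vec n)) (t : ℝ) (y : Vec n) : Vec n :=
  WithLp.toLp 2 fun i => smooth μ (scoreKernel t (EuclideanSpace.single i 1)) y / noisy μ t y

lemma measurable_noiseMean {μ : Measure (Vec n)} [IsProbabilityMeasure μ] {t : ℝ} (ht : 0 < t) :
    Measurable (noiseMean μ t) := by
  have h1 := (continuous_noisy (μ := μ) ht).measurable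
  have h2 := fun e : Vec n => (continuous_smooth μ (gaussianDecay_scoreKernel ht e)).measurable
  unfold noiseMean
  exact (WithLp.measurable_toLp 2 _).comp (measurable_pi_lambda _ fun i => (h2 _).div h1)

lemma integrable_sq_norm_map {Ω : Type*} [MeasurableSpace Ω] {P : Measure Ω} {X : Ω → Vec n}
    (hX : Measurable X) (hX2 : MemLp X 2 P) : Integrable (fun x => ‖x‖ ^ 2) (P.map X) := by
  rw [integrable_map_measure (by fun_prop) hX.aemeasurable]
  exact hX2.integrable_norm_pow (by norm_num)

section Channel

variable {Ω : Type*} [MeasurableSpace Ω] {P : Measure Ω} [IsProbabilityMeasure P]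
  {X W : Ω → Vec n} {t : ℝ}

lemma map_prodMk_eq (hX : Measurable X) (hW : Measurable W) (hXW : IndepFun X W P)
    (hlaw : P.map W = heatMeasure t) :
    P.map (fun ω => (X ω, W ω)) =
      ((P.map X).prod volume).withDensity fun z => ENNReal.ofReal (heatKernel t z.2) := by
  rw [(indepFun_iff_map_prod_eq_prod_map_map hX.aemeasurable hW.aemeasurable).1 hXW, hlaw,
    heatMeasure, prod_withDensity_right (by fun_prop)]

/-- The shear passes from signal and noise to signal and observation, so that integrating out x at
fixed y produces a convolution: κ = 1 gives the density of X + W, a linear κ the smoothed score. -/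
lemma integral_comp_add_mul (hX : Measurable X) (hW : Measurable W) (hXW : IndepFun X W P)
    (hlaw : P.map W = heatMeasure t) {φ κ : Vec n → ℝ} (hφ : Measurable φ) (hκ : Measurable κ) :
    ∫ ω, φ (X ω + W ω) * κ (W ω) ∂P =
      ∫ z, φ z.2 * (κ (z.2 - z.1) * heatKernel t (z.2 - z.1)) ∂((P.map X).prod volume) := by
  have : IsProbabilityMeasure (P.map X) := Measure.isProbabilityMeasure_map hX.aemeasurable
  rw [← integral_shear]
  have h := integral_map (μ := P) (φ := fun ω => (X ω, W ω)) (by fun_prop)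
    (f := fun z : Vec n × Vec n => φ (z.1 + z.2) * κ z.2)
    (by fun_prop)
  rw [← h, map_prodMk_eq hX hW hXW hlaw,
    integral_withDensity_eq_integral_toReal_smul (by fun_prop) (by simp)]
  refine integral_congr_ae (ae_of_all _ fun z => ?_)
  simp only [ENNReal.toReal_ofReal (heatKernel_pos t z.2).le, smul_eq_mul, add_sub_cancel_left]
  ring

lemma integrable_comp_add_mul_iff (hX : Measurable X) (hW : Measurable W) (hXW : IndepFun X W P)
    (hlaw : P.map W = heatMeasure t) {φ κ : Vec n → ℝ} (hφ : Measurable φ) (hκ : Measurable κ) :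
    Integrable (fun ω => φ (X ω + W ω) * κ (W ω)) P ↔
      Integrable (fun z => φ z.2 * (κ (z.2 - z.1) * heatKernel t (z.2 - z.1)))
        ((P.map X).prod volume) := by
  have : IsProbabilityMeasure (P.map X) := Measure.isProbabilityMeasure_map hX.aemeasurable
  rw [← integrable_shear_iff]
  have h := integrable_map_measure (μ := P) (f := fun ω => (X ω, W ω))
    (g := fun z : Vec n × Vec n => φ (z.1 + z.2) * κ z.2) (by fun_prop) (by fun_prop)
  refine Iff.trans h.symm ?_
  rw [map_prodMk_eq hX hW hXW hlaw, integrable_withDensity_iff_integrable_smul' (by fun_prop)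
    (by simp)]
  refine integrable_congr (ae_of_all _ fun z => ?_)
  simp only [ENNReal.toReal_ofReal (heatKernel_pos t z.2).le, smul_eq_mul, add_sub_cancel_left]
  ring

/-- The kernel is positive, so Tonelli loses nothing and no growth bound on φ is required; this
matters for φ built from quotients by the noisy density. -/
lemma integrable_mul_heatKernel_prod {μ : Measure (Vec n)} [IsProbabilityMeasure μ]
    (ht : 0 < t) {φ : Vec n → ℝ} (hφ : Measurable φ)
    (h : Integrable (fun y => φ y * noisy μ t y)) :
    Integrable (fun z : Vec n × Vec n => φ z.2 * heatKernel t (z.2 - z.1))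
      (μ.prod volume) := by
  have hm : AEStronglyMeasurable (fun z : Vec n × Vec n => φ z.2 * heatKernel t (z.2 - z.1))
      (μ.prod volume) :=
    ((hφ.comp measurable_snd).mul ((continuous_heatKernel t).measurable.comp
      (measurable_snd.sub measurable_fst))).aestronglyMeasurable
  refine (integrable_prod_iff' hm).2 ⟨ae_of_all _ fun y =>
    ((gaussianDecay_heatKernel ht).integrable_sub μ y).const_mul (φ y), ?_⟩
  refine h.norm.congr (ae_of_all _ fun y => ?_)
  have h0 : 0 ≤ noisy μ t y := integral_nonneg fun x => (heatKernel_pos t _).le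
  simp only [norm_mul, integral_const_mul, Real.norm_of_nonneg (heatKernel_pos t _).le,
    Real.norm_of_nonneg h0]
  rfl

lemma integrable_comp_add (ht : 0 < t) (hX : Measurable X) (hW : Measurable W)
    (hXW : IndepFun X W P) (hlaw : P.map W = heatMeasure t) {φ : Vec n → ℝ} (hφ : Measurable φ)
    (h : Integrable (fun y => φ y * noisy (P.map X) t y)) :
    Integrable (fun ω => φ (X ω + W ω)) P := by
  have : IsProbabilityMeasure (P.map X) := Measure.isProbabilityMeasure_map hX.aemeasurable
  have h1 := (integrable_comp_add_mul_iff hX hW hXW hlaw hφ (measurable_const (a := (1 : ℝ)))).2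
    (by simpa using integrable_mul_heatKernel_prod ht hφ h)
  simpa using h1

lemma integral_comp_add (ht : 0 < t) (hX : Measurable X) (hW : Measurable W)
    (hXW : IndepFun X W P) (hlaw : P.map W = heatMeasure t) {φ : Vec n → ℝ} (hφ : Measurable φ)
    (h : Integrable (fun y => φ y * noisy (P.map X) t y)) :
    ∫ ω, φ (X ω + W ω) ∂P = ∫ y, φ y * noisy (P.map X) t y := by
  have : IsProbabilityMeasure (P.map X) := Measure.isProbabilityMeasure_map hX.aemeasurable
  have h1 := integral_comp_add_mul hX hW hXW hlaw hφ (measurable_const (a := (1 : ℝ)))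
  simp only [mul_one, one_mul] at h1
  rw [h1, integral_prod_symm _ (integrable_mul_heatKernel_prod ht hφ h)]
  simp only [integral_const_mul]
  rfl

lemma integrable_noiseMean_comp (hX : Measurable X) (hW : Measurable W) (hXW : IndepFun X W P)
    (hlaw : P.map W = heatMeasure t) (ht : 0 < t) (hX2 : MemLp X 2 P) :
    Integrable (fun ω => noiseMean (P.map X) t (X ω + W ω)) P := by
  have : IsProbabilityMeasure (P.map X) := Measure.isProbabilityMeasure_map hX.aemeasurable
  have hμ := integrable_sq_norm_map hX hX2
  refine Integrable.of_eval_piLp fun i => ?_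
  have h1 := (continuous_noisy (μ := P.map X) ht).measurable
  have h2 := (continuous_smooth (P.map X)
    (gaussianDecay_scoreKernel ht (EuclideanSpace.single i 1))).measurable
  refine integrable_comp_add ht hX hW hXW hlaw (h2.div h1)
    ((integrable_smooth hμ (gaussianDecay_scoreKernel ht (EuclideanSpace.single i 1))).congr
      (ae_of_all _ fun y => ?_))
  simp only [Pi.div_apply]
  rw [div_mul_cancel₀ _ (noisy_pos hμ ht y).ne']

/-- Bayes' formula: given X + W = y, the signal has law proportional to g_t(y - x) dμ(x), and the
noise is y - x. Tested on {X + W ∈ A} in each coordinate, both sides equal the integral over A of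
the smoothed score, the denominator cancelling against the density of X + W. -/
theorem condExp_noise_ae_eq (hX : Measurable X) (hW : Measurable W) (hXW : IndepFun X W P)
    (hlaw : P.map W = heatMeasure t) (ht : 0 < t) (hX2 : MemLp X 2 P)
    (hW1 : Integrable W P) :
    P[W | MeasurableSpace.comap (fun ω => X ω + W ω) inferInstance]
      =ᵐ[P] fun ω => noiseMean (P.map X) t (X ω + W ω) := by
  have : IsProbabilityMeasure (P.map X) := Measure.isProbabilityMeasure_map hX.aemeasurable
  have hμ := integrable_sq_norm_map hX hX2
  have hint := integrable_noiseMean_comp hX hW hXW hlaw ht hX2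
  have hm : MeasurableSpace.comap (fun ω => X ω + W ω) inferInstance ≤
      (inferInstance : MeasurableSpace Ω) := (hX.add hW).comap_le
  refine (ae_eq_condExp_of_forall_setIntegral_eq hm hW1 (fun s _ _ => hint.integrableOn) ?_
    ?_).symm
  · rintro s ⟨A, hA, rfl⟩ -
    ext i
    have hproj : ∀ {f : Ω → Vec n} (s : Set Ω), Integrable f P →
        (∫ ω in s, f ω ∂P) i = ∫ ω in s, f ω i ∂P := fun {f} s hf =>
      ((EuclideanSpace.proj i : Vec n →L[ℝ] ℝ).integral_comp_comm hf.integrableOn).symm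
    rw [hproj _ hint, hproj _ hW1]
    have hA' : MeasurableSet ((fun ω => X ω + W ω) ⁻¹' A) := (hX.add hW) hA
    rw [← integral_indicator hA', ← integral_indicator hA']
    have h1 := (continuous_noisy (μ := P.map X) ht).measurable
    have h2 := (continuous_smooth (P.map X)
      (gaussianDecay_scoreKernel ht (EuclideanSpace.single i 1))).measurable
    set S := smooth (P.map X) (scoreKernel t (EuclideanSpace.single i 1)) with hS
    have hSi : Integrable S := integrable_smooth hμ (gaussianDecay_scoreKernel ht _)
    have hφ : Measurable (A.indicator fun y => S y / noisy (P.map X) t y) :=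
      (h2.div h1).indicator hA
    have e0 : ∀ y, A.indicator (fun y => S y / noisy (P.map X) t y) y * noisy (P.map X) t y
        = A.indicator S y := fun y => by
      by_cases hy : y ∈ A
      · simp [hy, div_mul_cancel₀ _ (noisy_pos hμ ht y).ne']
      · simp [hy]
    have e1 := integral_comp_add ht hX hW hXW hlaw hφ
      ((hSi.indicator hA).congr (ae_of_all _ fun y => (e0 y).symm))
    simp_rw [e0] at e1
    have e2 := integral_comp_add_mul hX hW hXW hlaw (φ := A.indicator fun _ => (1 : ℝ))
      (κ := fun v => inner ℝ v (EuclideanSpace.single i 1)) (measurable_const.indicator hA)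
      (by fun_prop)
    have hk := integrable_mul_kernel_prod hμ
      (gaussianDecay_scoreKernel ht (EuclideanSpace.single i 1))
      (A := A.indicator fun _ => (1 : ℝ)) (measurable_const.indicator hA) (B := 1) fun y => by
        by_cases hy : y ∈ A
        · simp [hy]
        · simp [hy]; positivity
    have e3 := integral_prod_symm _ hk
    simp only [integral_const_mul] at e3
    calc ∫ ω, ((fun ω => X ω + W ω) ⁻¹' A).indicator
          (fun ω => noiseMean (P.map X) t (X ω + W ω) i) ω ∂P
        = ∫ ω, A.indicator (fun y => S y / noisy (P.map X) t y) (X ω + W ω) ∂P := by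
          refine integral_congr_ae (ae_of_all _ fun ω => ?_)
          by_cases hy : X ω + W ω ∈ A <;> simp [hy, noiseMean, hS]
      _ = ∫ y, A.indicator S y := e1
      _ = ∫ y, A.indicator (fun _ => (1 : ℝ)) y * S y := by
          refine integral_congr_ae (ae_of_all _ fun y => ?_)
          by_cases hy : y ∈ A <;> simp [hy]
      _ = ∫ ω, A.indicator (fun _ => (1 : ℝ)) (X ω + W ω) *
            inner ℝ (W ω) (EuclideanSpace.single i 1) ∂P := (e2.trans e3).symm
      _ = _ := by
          refine integral_congr_ae (ae_of_all _ fun ω => ?_)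
          by_cases hy : X ω + W ω ∈ A <;>
            simp [hy, EuclideanSpace.inner_single_right]
  · have hc : Measurable[MeasurableSpace.comap (fun ω => X ω + W ω) inferInstance]
        (fun ω => X ω + W ω) := comap_measurable _
    exact ((measurable_noiseMean ht).comp hc).stronglyMeasurable.aestronglyMeasurable

theorem integral_sq_norm_noiseMean_comp (hX : Measurable X) (hW : Measurable W) (hXW : IndepFun X W P)
    (hlaw : P.map W = heatMeasure t) (ht : 0 < t) (hX2 : MemLp X 2 P) :
    Integrable (fun ω => ‖noiseMean (P.map X) t (X ω + W ω)‖ ^ 2) P ∧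
    ∫ ω, ‖noiseMean (P.map X) t (X ω + W ω)‖ ^ 2 ∂P = noiseEnergy (P.map X) t := by
  have : IsProbabilityMeasure (P.map X) := Measure.isProbabilityMeasure_map hX.aemeasurable
  have hμ := integrable_sq_norm_map hX hX2
  have e : ∀ y, ‖noiseMean (P.map X) t y‖ ^ 2 * noisy (P.map X) t y = ∑ i,
      smooth (P.map X) (scoreKernel t (EuclideanSpace.single i 1)) y ^ 2 /
        noisy (P.map X) t y := fun y => by
    have h0 := (noisy_pos hμ ht y).ne'
    rw [EuclideanSpace.norm_sq_eq, Finset.sum_mul]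
    refine Finset.sum_congr rfl fun i _ => ?_
    simp only [noiseMean, Real.norm_eq_abs, sq_abs]
    field_simp
  have hsum := integrable_finsetSum (μ := (volume : Measure (Vec n))) Finset.univ
    (f := fun i y => smooth (P.map X) (scoreKernel t (EuclideanSpace.single i 1)) y ^ 2 /
      noisy (P.map X) t y) fun i _ => integrable_sq_smooth_scoreKernel_div hμ ht _
  have hI : Integrable (fun y => ‖noiseMean (P.map X) t y‖ ^ 2 * noisy (P.map X) t y) :=
    hsum.congr (ae_of_all _ fun y => (e y).symm)
  have hm : Measurable (fun y => ‖noiseMean (P.map X) t y‖ ^ 2) :=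
    (measurable_noiseMean ht).norm.pow_const 2
  refine ⟨integrable_comp_add ht hX hW hXW hlaw hm hI, ?_⟩
  rw [integral_comp_add ht hX hW hXW hlaw hm hI]
  simp_rw [e]
  rw [integral_finsetSum _ fun i _ => integrable_sq_smooth_scoreKernel_div hμ ht _]
  rfl

end Channel

end EPI

-- Relative entropy with respect to a Gaussian, and entropy under convolution.

namespace EPI

variable {n : ℕ}

/-- The tangent line bound for the concave function `-a log a`. -/
lemma negMulLog_le {a b : ℝ} (ha : 0 ≤ a) (hb : 0 < b) :
    Real.negMulLog a ≤ -(a * Real.log b) + b - a := by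
  rcases ha.eq_or_lt with rfl | ha
  · simpa using hb.le
  · have h := Real.log_le_sub_one_of_pos (div_pos hb ha)
    rw [Real.log_div hb.ne' ha.ne'] at h
    have h2 := mul_le_mul_of_nonneg_left h ha.le
    have h3 : a * (b / a - 1) = b - a := by field_simp
    rw [Real.negMulLog]
    linarith

/-- A probability density on `ℝⁿ` with finite second moment. -/
structure IsDensity (f : Vec n → ℝ) : Prop where
  measurable : Measurable f
  nonneg : ∀ y, 0 ≤ f y
  integrable : Integrable f
  integral_eq_one : ∫ y, f y = 1
  integrable_sq : Integrable (fun y => ‖y‖ ^ 2 * f y)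

/-- The integrand of the relative entropy of `f` with respect to the standard Gaussian. -/
def klIntegrand (f : Vec n → ℝ) (y : Vec n) : ℝ :=
  -(f y * Real.log (heatKernel 1 y)) + heatKernel 1 y - f y - Real.negMulLog (f y)

/-- The relative entropy of `f` with respect to the standard Gaussian. -/
def relEnt (f : Vec n → ℝ) : ℝ≥0∞ := ∫⁻ y, ENNReal.ofReal (klIntegrand f y)

/-- The cross entropy of `f` relative to the standard Gaussian. -/
def crossEnt (f : Vec n → ℝ) : ℝ := n / 2 * Real.log (2 * Real.pi) + (∫ y, ‖y‖ ^ 2 * f y) / 2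

namespace IsDensity

variable {f : Vec n → ℝ} (hf : IsDensity f)
include hf

/-- The terms g - f in the integrand have total integral zero; they are included to make it
nonnegative pointwise, so that Fatou's lemma applies to the relative entropy. -/
lemma klIntegrand_nonneg (y : Vec n) : 0 ≤ klIntegrand f y :=
  sub_nonneg.2 (negMulLog_le (hf.nonneg y) (heatKernel_pos 1 y))

lemma measurable_klIntegrand : Measurable (klIntegrand f) := by
  have h1 := hf.measurable
  have h2 := (continuous_heatKernel (n := n) 1).measurable
  have h3 := Real.measurable_log.comp h2
  have h4 := Real.continuous_negMulLog.measurable.comp h1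
  exact (((h1.mul h3).neg.add h2).sub h1).sub h4

lemma integrable_mul_log_heatKernel (t : ℝ) :
    Integrable (fun y => f y * Real.log (heatKernel t y)) := by
  simp_rw [log_heatKernel]
  refine ((hf.integrable.const_mul (-(n / 2 * Real.log (2 * Real.pi * t)))).sub
    (hf.integrable_sq.div_const (2 * t))).congr (ae_of_all _ fun y => ?_)
  simp only [Pi.sub_apply]
  ring

lemma integral_mul_log_heatKernel (t : ℝ) :
    ∫ y, f y * Real.log (heatKernel t y) =
      -(n / 2 * Real.log (2 * Real.pi * t)) - (∫ y, ‖y‖ ^ 2 * f y) / (2 * t) := by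
  simp_rw [log_heatKernel]
  have e : ∀ y, f y * (-(n / 2 * Real.log (2 * Real.pi * t)) - ‖y‖ ^ 2 / (2 * t))
      = -(n / 2 * Real.log (2 * Real.pi * t)) * f y - ‖y‖ ^ 2 * f y / (2 * t) := fun y => by ring
  simp_rw [e]
  rw [integral_sub (hf.integrable.const_mul _) (hf.integrable_sq.div_const _),
    integral_const_mul, integral_div, hf.integral_eq_one, mul_one]

lemma integrable_majorant {t : ℝ} (ht : 0 < t) :
    Integrable (fun y => -(f y * Real.log (heatKernel t y)) + heatKernel t y - f y) :=
  ((hf.integrable_mul_log_heatKernel t).neg.add (integrable_heatKernel ht)).sub hf.integrable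

lemma integral_majorant {t : ℝ} (ht : 0 < t) :
    ∫ y, (-(f y * Real.log (heatKernel t y)) + heatKernel t y - f y) =
      n / 2 * Real.log (2 * Real.pi * t) + (∫ y, ‖y‖ ^ 2 * f y) / (2 * t) := by
  have h1 : Integrable (fun y => -(f y * Real.log (heatKernel t y))) :=
    (hf.integrable_mul_log_heatKernel t).neg
  have h2 : Integrable (fun y => -(f y * Real.log (heatKernel t y)) + heatKernel t y) :=
    h1.add (integrable_heatKernel ht)
  rw [integral_sub h2 hf.integrable, integral_add h1 (integrable_heatKernel ht), integral_neg,
    hf.integral_mul_log_heatKernel, integral_heatKernel ht, hf.integral_eq_one]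
  ring

/-- Gibbs' inequality: entropy is at most cross entropy, here against the centred Gaussian of
covariance t. -/
lemma integral_negMulLog_le {t : ℝ} (ht : 0 < t)
    (h : Integrable (fun y => Real.negMulLog (f y))) :
    ∫ y, Real.negMulLog (f y) ≤
      n / 2 * Real.log (2 * Real.pi * t) + (∫ y, ‖y‖ ^ 2 * f y) / (2 * t) := by
  rw [← hf.integral_majorant ht]
  exact integral_mono h (hf.integrable_majorant ht) fun y =>
    negMulLog_le (hf.nonneg y) (heatKernel_pos t y)

lemma lintegral_negMulLog_ne_top : ∫⁻ y, ENNReal.ofReal (Real.negMulLog (f y)) ≠ ∞ := by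
  refine ((lintegral_mono fun y => ENNReal.ofReal_le_ofReal
    (negMulLog_le (hf.nonneg y) (heatKernel_pos 1 y))).trans_lt
      (hf.integrable_majorant one_pos).lintegral_lt_top).ne

lemma relEnt_ne_top_iff : relEnt f ≠ ∞ ↔ Integrable (fun y => Real.negMulLog (f y)) := by
  have h1 : relEnt f ≠ ∞ ↔ Integrable (klIntegrand f) := by
    rw [← lt_top_iff_ne_top, relEnt, ← hasFiniteIntegral_iff_ofReal
      (ae_of_all _ hf.klIntegrand_nonneg)]
    exact ⟨fun h => ⟨hf.measurable_klIntegrand.aestronglyMeasurable, h⟩, fun h => h.2⟩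
  rw [h1]
  have hM := hf.integrable_majorant one_pos
  refine ⟨fun h => (hM.sub h).congr (ae_of_all _ fun y => ?_), fun h =>
    (hM.sub h).congr (ae_of_all _ fun y => ?_)⟩ <;> simp [klIntegrand]

lemma integral_negMulLog (h : Integrable (fun y => Real.negMulLog (f y))) :
    ∫ y, Real.negMulLog (f y) = crossEnt f - (relEnt f).toReal := by
  have hM := hf.integrable_majorant one_pos
  have hk : Integrable (klIntegrand f) := (hM.sub h).congr (ae_of_all _ fun y => rfl)
  rw [relEnt, ← integral_eq_lintegral_of_nonneg_ae (ae_of_all _ hf.klIntegrand_nonneg) hk.1]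
  have e : ∫ y, klIntegrand f y = (∫ y, (-(f y * Real.log (heatKernel 1 y)) + heatKernel 1 y - f y))
      - ∫ y, Real.negMulLog (f y) := integral_sub hM h
  rw [e, hf.integral_majorant one_pos, crossEnt]
  simp

/-- The differential entropy in terms of the relative entropy. -/
lemma lintegral_sub_lintegral_eq :
    ((∫⁻ y, ENNReal.ofReal (Real.negMulLog (f y)) : ℝ≥0∞) : EReal) -
      ((∫⁻ y, ENNReal.ofReal (-Real.negMulLog (f y)) : ℝ≥0∞) : EReal) =
      (crossEnt f : EReal) - (relEnt f : EReal) := by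
  have hpos := hf.lintegral_negMulLog_ne_top
  have hmeas : Measurable (fun y => Real.negMulLog (f y)) :=
    Real.continuous_negMulLog.measurable.comp hf.measurable
  -- The positive part of the entropy is always finite, so infinite relative entropy forces an
  -- infinite negative part, and both sides are -∞.
  by_cases h : relEnt f = ∞
  · have hneg : ∫⁻ y, ENNReal.ofReal (-Real.negMulLog (f y)) = ∞ := by
      by_contra hneg
      refine hf.relEnt_ne_top_iff.2 ⟨hmeas.aestronglyMeasurable, ?_⟩ h
      have e : ∀ y, ‖Real.negMulLog (f y)‖ₑ = ENNReal.ofReal (Real.negMulLog (f y)) +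
          ENNReal.ofReal (-Real.negMulLog (f y)) := fun y => by
        rw [← ofReal_norm, Real.norm_eq_abs]
        rcases le_total 0 (Real.negMulLog (f y)) with h0 | h0
        · rw [abs_of_nonneg h0, ENNReal.ofReal_of_nonpos (neg_nonpos.2 h0), add_zero]
        · rw [abs_of_nonpos h0, ENNReal.ofReal_of_nonpos h0, zero_add]
      rw [HasFiniteIntegral]
      simp_rw [e]
      rw [lintegral_add_left hmeas.ennreal_ofReal]
      exact ENNReal.add_lt_top.2 ⟨hpos.lt_top, Ne.lt_top hneg⟩
    rw [hneg, h]
    lift (∫⁻ y, ENNReal.ofReal (Real.negMulLog (f y))) to NNReal using hpos with a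
    rfl
  · have hi := hf.relEnt_ne_top_iff.1 h
    have h1 := hf.integral_negMulLog hi
    have hneg : ∫⁻ y, ENNReal.ofReal (-Real.negMulLog (f y)) ≠ ∞ := hi.neg.lintegral_lt_top.ne
    rw [integral_eq_lintegral_pos_part_sub_lintegral_neg_part hi] at h1
    lift (∫⁻ y, ENNReal.ofReal (Real.negMulLog (f y))) to NNReal using hpos with a
    lift (∫⁻ y, ENNReal.ofReal (-Real.negMulLog (f y))) to NNReal using hneg with b
    lift relEnt f to NNReal using h with d
    simp only [ENNReal.coe_toReal] at h1
    change ((a : ℝ) : EReal) - ((b : ℝ) : EReal) = (crossEnt f : EReal) - ((d : ℝ) : EReal)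
    rw [← EReal.coe_sub, ← EReal.coe_sub, h1]

end IsDensity

/-- Differential entropy does not decrease under convolution with a probability measure. -/
lemma integral_negMulLog_le_of_convolution {ν : Measure (Vec n)} [IsProbabilityMeasure ν]
    {f q : Vec n → ℝ} (hf : Measurable f) (hf0 : ∀ y, 0 ≤ f y) (hfi : Integrable f)
    (hfe : Integrable (fun y => Real.negMulLog (f y))) (hq : Measurable q) (hq0 : ∀ y, 0 < q y)
    (hqi : Integrable q) (hqe : Integrable (fun y => Real.negMulLog (q y)))
    (hconv : ∀ y, q y = ∫ u, f (y - u) ∂ν) :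
    ∫ y, Real.negMulLog (f y) ≤ ∫ y, Real.negMulLog (q y) := by
  -- The tangent bound is averaged at a = f(y - u), b = q(y) over ν ⊗ dy. The masses of f and q
  -- cancel, and since q averages the translates of f, the logarithmic term integrates to the
  -- entropy of q.
  have hsub : ∀ {g : Vec n → ℝ}, Integrable g →
      Integrable (fun z : Vec n × Vec n => g (z.2 - z.1)) (ν.prod volume) ∧
      ∫ z : Vec n × Vec n, g (z.2 - z.1) ∂(ν.prod volume) = ∫ y, g y := fun {g} hg => by
    rw [← integrable_shear_iff, ← integral_shear]
    simp only [add_sub_cancel_left]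
    refine ⟨hg.comp_snd ν, ?_⟩
    rw [integral_fun_snd]
    simp
  obtain ⟨iA, eA⟩ := hsub hfe
  obtain ⟨iB, eB⟩ := hsub hfi
  have iD : Integrable (fun z : Vec n × Vec n => q z.2) (ν.prod volume) := hqi.comp_snd ν
  have eD : ∫ z : Vec n × Vec n, q z.2 ∂(ν.prod volume) = ∫ y, f y := by
    rw [integral_fun_snd, ← eB, integral_prod_symm _ iB]
    simp [hconv]
  have hm : Measurable (fun z : Vec n × Vec n => f (z.2 - z.1) * Real.log (q z.2)) :=
    (hf.comp (measurable_snd.sub measurable_fst)).mul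
      (Real.measurable_log.comp (hq.comp measurable_snd))
  have iC : Integrable (fun z : Vec n × Vec n => f (z.2 - z.1) * Real.log (q z.2))
      (ν.prod volume) := by
    refine (integrable_prod_iff' hm.aestronglyMeasurable).2 ⟨?_, ?_⟩
    · filter_upwards [((integrable_prod_iff' iB.1).1 iB).1] with y hy
      exact hy.mul_const _
    · refine hqe.norm.congr (ae_of_all _ fun y => ?_)
      simp only [norm_mul, Real.norm_of_nonneg (hf0 _), integral_mul_const, Real.negMulLog,
        norm_neg, Real.norm_of_nonneg (hq0 y).le, ← hconv y]
  have eC : ∫ z : Vec n × Vec n, f (z.2 - z.1) * Real.log (q z.2) ∂(ν.prod volume)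
      = -∫ y, Real.negMulLog (q y) := by
    rw [integral_prod_symm _ iC, ← integral_neg]
    refine integral_congr_ae (ae_of_all _ fun y => ?_)
    simp only [integral_mul_const, Real.negMulLog, ← hconv y]
    ring
  have iCn : Integrable (fun z : Vec n × Vec n => -(f (z.2 - z.1) * Real.log (q z.2)))
      (ν.prod volume) := iC.neg
  have iCD : Integrable (fun z : Vec n × Vec n => -(f (z.2 - z.1) * Real.log (q z.2)) + q z.2)
      (ν.prod volume) := iCn.add iD
  have h : ∫ z : Vec n × Vec n, Real.negMulLog (f (z.2 - z.1)) ∂(ν.prod volume) ≤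
      ∫ z : Vec n × Vec n, (-(f (z.2 - z.1) * Real.log (q z.2)) + q z.2 - f (z.2 - z.1))
        ∂(ν.prod volume) :=
    integral_mono iA (iCD.sub iB) fun z => negMulLog_le (hf0 (z.2 - z.1)) (hq0 z.2)
  rw [eA, integral_sub iCD iB, integral_add iCn iD, integral_neg, eC, eD, eB] at h
  linarith

end EPI

-- Moments and entropy bounds for the noisy density.

namespace EPI

variable {n : ℕ}

/-- The second moment of the standard Gaussian law on `ℝⁿ`. -/
def gaussianMoment (n : ℕ) : ℝ := ∫ z, ‖z‖ ^ 2 ∂(stdGaussian (Vec n))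

lemma integrable_sq_mul_heatKernel {t : ℝ} (ht : 0 < t) :
    Integrable (fun v : Vec n => ‖v‖ ^ 2 * heatKernel t v) := by
  refine Integrable.mono' (integrable_poly_mul_heatKernel 1 ht) (by fun_prop)
    (ae_of_all _ fun v => ?_)
  have := heatKernel_pos t v
  rw [Real.norm_of_nonneg (by positivity), pow_one]
  gcongr
  linarith

lemma integral_sq_mul_heatKernel {t : ℝ} (ht : 0 < t) :
    ∫ v : Vec n, ‖v‖ ^ 2 * heatKernel t v = t * gaussianMoment n := by
  have h := integral_heatMeasure t (fun v : Vec n => ‖v‖ ^ 2)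
  simp only [smul_eq_mul, mul_comm (heatKernel t _)] at h
  rw [← h, ← map_smul_stdGaussian ht, integral_map (by fun_prop) (by fun_prop), gaussianMoment,
    ← integral_const_mul]
  simp_rw [norm_smul, mul_pow, Real.norm_of_nonneg (Real.sqrt_nonneg t), Real.sq_sqrt ht.le]

lemma integral_inner_mul_heatKernel (t : ℝ) (x : Vec n) :
    ∫ v : Vec n, inner ℝ x v * heatKernel t v = 0 := by
  have h := integral_neg_eq_self (fun v : Vec n => inner ℝ x v * heatKernel t v) volume
  simp only [heatKernel_neg, inner_neg_right, neg_mul, integral_neg] at h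
  linarith

section Noisy

variable {μ : Measure (Vec n)} [IsProbabilityMeasure μ]

lemma integral_mul_smooth (hμ : Integrable (fun x => ‖x‖ ^ 2) μ) {k A : Vec n → ℝ}
    (hk : GaussianDecay k) (hA : Measurable A) {B : ℝ} (hB : ∀ y, |A y| ≤ B * (1 + ‖y‖ ^ 2)) :
    ∫ y, A y * smooth μ k y = ∫ x, (∫ v, A (x + v) * k v) ∂μ := by
  have hi := integrable_mul_kernel_prod hμ hk hA hB
  have h1 := integral_prod_symm _ hi
  rw [← integral_shear] at h1
  have hi2 := (integrable_shear_iff _ _).2 hi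
  simp only [add_sub_cancel_left] at h1 hi2
  rw [integral_prod _ hi2] at h1
  simp only [integral_const_mul] at h1
  exact h1.symm

lemma integral_noisy (hμ : Integrable (fun x => ‖x‖ ^ 2) μ) {t : ℝ} (ht : 0 < t) :
    ∫ y, noisy μ t y = 1 := by
  have h := integral_mul_smooth hμ (gaussianDecay_heatKernel ht) (A := fun _ => 1)
    measurable_const (B := 1) (fun y => by simp)
  simp only [one_mul, integral_heatKernel ht] at h
  simpa [noisy] using h

lemma integral_sq_mul_noisy (hμ : Integrable (fun x => ‖x‖ ^ 2) μ) {t : ℝ} (ht : 0 < t) :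
    ∫ y, ‖y‖ ^ 2 * noisy μ t y = ∫ x, ‖x‖ ^ 2 ∂μ + t * gaussianMoment n := by
  have h := integral_mul_smooth hμ (gaussianDecay_heatKernel ht) (A := fun y => ‖y‖ ^ 2)
    (by fun_prop) (B := 1) (fun y => by
      rw [abs_of_nonneg (by positivity)]
      linarith)
  rw [noisy, h]
  have e : ∀ x : Vec n, ∫ v, ‖x + v‖ ^ 2 * heatKernel t v = ‖x‖ ^ 2 + t * gaussianMoment n :=
    fun x => by
    have e1 : ∀ v, ‖x + v‖ ^ 2 * heatKernel t v = ‖x‖ ^ 2 * heatKernel t v +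
        2 * (inner ℝ x v * heatKernel t v) + ‖v‖ ^ 2 * heatKernel t v := fun v => by
      rw [norm_add_sq_real]; ring
    have i1 : Integrable (fun v : Vec n => ‖x‖ ^ 2 * heatKernel t v) :=
      (integrable_heatKernel ht).const_mul _
    have i2 : Integrable (fun v : Vec n => 2 * (inner ℝ x v * heatKernel t v)) := by
      refine Integrable.const_mul ?_ _
      refine Integrable.mono' ((integrable_poly_mul_heatKernel 1 ht).const_mul (1 + ‖x‖ ^ 2))
        (by fun_prop) (ae_of_all _ fun v => ?_)
      have h0 := heatKernel_pos t v
      rw [norm_mul, Real.norm_of_nonneg h0.le, ← mul_assoc, pow_one]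
      gcongr
      have := norm_inner_le_norm (𝕜 := ℝ) x v
      nlinarith [sq_nonneg (‖x‖ - ‖v‖), sq_nonneg (‖x‖ * ‖v‖)]
    have i3 : Integrable (fun v : Vec n => ‖x‖ ^ 2 * heatKernel t v +
        2 * (inner ℝ x v * heatKernel t v)) := i1.add i2
    simp_rw [e1]
    rw [integral_add i3 (integrable_sq_mul_heatKernel ht), integral_add i1 i2, integral_const_mul,
      integral_const_mul, integral_heatKernel ht, integral_inner_mul_heatKernel,
      integral_sq_mul_heatKernel ht]
    ring
  simp_rw [e]
  rw [integral_add hμ (integrable_const _)]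
  simp

lemma isDensity_noisy (hμ : Integrable (fun x => ‖x‖ ^ 2) μ) {t : ℝ} (ht : 0 < t) :
    IsDensity (noisy μ t) where
  measurable := (continuous_noisy ht).measurable
  nonneg y := (noisy_pos hμ ht y).le
  integrable := integrable_noisy hμ ht
  integral_eq_one := integral_noisy hμ ht
  integrable_sq := integrable_mul_smooth hμ (gaussianDecay_heatKernel ht) (by fun_prop) (B := 1)
    fun y => by
      rw [abs_of_nonneg (by positivity)]
      linarith

lemma isDensity_density (hac : μ ≪ volume) (hμ : Integrable (fun x => ‖x‖ ^ 2) μ) :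
    IsDensity (density μ) where
  measurable := (Measure.measurable_rnDeriv μ volume).ennreal_toReal
  nonneg _ := ENNReal.toReal_nonneg
  integrable := Measure.integrable_toReal_rnDeriv
  integral_eq_one := by
    unfold density
    rw [Measure.integral_toReal_rnDeriv hac]
    simp
  integrable_sq := ((integrable_rnDeriv_smul_iff hac).2 hμ).congr (ae_of_all _ fun y => by
    simp only [smul_eq_mul, density]
    ring)

lemma integral_sq_mul_density (hac : μ ≪ volume) :
    ∫ y, ‖y‖ ^ 2 * density μ y = ∫ x, ‖x‖ ^ 2 ∂μ := by
  rw [← integral_rnDeriv_smul hac]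
  simp only [smul_eq_mul, density, mul_comm]

lemma hasEntropy (hac : μ ≪ volume) (hμ : Integrable (fun x => ‖x‖ ^ 2) μ) : HasEntropy μ :=
  ⟨hac, (isDensity_density hac hμ).lintegral_negMulLog_ne_top⟩

/-- Commutativity of convolution: the noisy density is now an average of translates of the signal's
density, the form used for both entropy monotonicity and L¹ convergence. -/
lemma noisy_eq_integral_density (hac : μ ≪ volume) (t : ℝ) (y : Vec n) :
    noisy μ t y = ∫ u, density μ (y - u) ∂(heatMeasure t) := by
  rw [integral_heatMeasure, noisy, smooth, ← integral_rnDeriv_smul hac,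
    ← integral_sub_left_eq_self (fun u => heatKernel t u • density μ (y - u)) volume y]
  refine integral_congr_ae (ae_of_all _ fun x => ?_)
  simp only [smul_eq_mul, density, sub_sub_cancel]
  ring

/-- The entropy of the noisy observation dominates that of the signal. -/
lemma integral_negMulLog_density_le (hac : μ ≪ volume) (hμ : Integrable (fun x => ‖x‖ ^ 2) μ)
    {t : ℝ} (ht : 0 < t) (h : Integrable (fun y => Real.negMulLog (density μ y))) :
    ∫ y, Real.negMulLog (density μ y) ≤ noisyEntropy μ t := by
  have := isProbabilityMeasure_heatMeasure (n := n) ht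
  have hd := isDensity_density hac hμ
  exact integral_negMulLog_le_of_convolution hd.measurable hd.nonneg hd.integrable h
    (continuous_noisy ht).measurable (noisy_pos hμ ht) (integrable_noisy hμ ht)
    (integrable_negMulLog_noisy hμ ht) (noisy_eq_integral_density hac t)

/-- Viewing pure noise as a noisy zero signal transfers the general integrability results to the
heat kernel. -/
lemma noisy_dirac_zero (t : ℝ) : noisy (Measure.dirac (0 : Vec n)) t = heatKernel t := by
  ext y
  simp [noisy, smooth]

/-- The entropy of the noisy observation dominates that of the noise, and is at most that of the
Gaussian law with the same second moment. -/
lemma noisyEntropy_bounds (hμ : Integrable (fun x => ‖x‖ ^ 2) μ) {t : ℝ} (ht : 0 < t) :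
    n / 2 * Real.log (2 * Real.pi * t) + gaussianMoment n / 2 ≤ noisyEntropy μ t ∧
    noisyEntropy μ t ≤ n / 2 * Real.log (2 * Real.pi * t) + gaussianMoment n / 2 +
      (∫ x, ‖x‖ ^ 2 ∂μ) / (2 * t) := by
  constructor
  · have h0 : Integrable (fun x : Vec n => ‖x‖ ^ 2) (Measure.dirac 0) :=
      integrable_dirac (by simp)
    have hi := integrable_negMulLog_noisy h0 ht
    rw [noisy_dirac_zero] at hi
    -- Here the roles are reversed: the noise is the density and the signal's law is the averaging
    -- measure.
    have h := integral_negMulLog_le_of_convolution (continuous_heatKernel t).measurable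
      (fun v => (heatKernel_pos t v).le) (integrable_heatKernel ht) hi
      (continuous_noisy (μ := μ) ht).measurable (noisy_pos hμ ht) (integrable_noisy hμ ht)
      (integrable_negMulLog_noisy hμ ht) (fun y => rfl)
    refine le_trans (le_of_eq ?_) h
    have hd := isDensity_noisy h0 ht
    rw [noisy_dirac_zero] at hd
    have e := hd.integral_mul_log_heatKernel t
    rw [integral_sq_mul_heatKernel ht] at e
    have e2 : ∫ y : Vec n, Real.negMulLog (heatKernel t y) =
        -∫ y : Vec n, heatKernel t y * Real.log (heatKernel t y) := by
      rw [← integral_neg]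
      simp only [Real.negMulLog, neg_mul]
    rw [e2, e]
    field_simp
    ring
  -- The comparison Gaussian has the covariance t of the noise alone; the resulting excess is the
  -- second moment of μ over 2t, which vanishes as t → ∞.
  · have h := (isDensity_noisy hμ ht).integral_negMulLog_le ht (integrable_negMulLog_noisy hμ ht)
    rw [integral_sq_mul_noisy hμ ht] at h
    refine h.trans (le_of_eq ?_)
    field_simp
    ring

/-! ### Convergence as the noise vanishes -/

/-- Translation is continuous in `L¹`. -/
lemma tendsto_lintegral_enorm_translate_sub {f : Vec n → ℝ} (hf : Integrable f) :
    Tendsto (fun h : Vec n => ∫⁻ y, ‖f (y - h) - f y‖ₑ) (𝓝 0) (𝓝 0) := by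
  have hL : MemLp f 1 volume := memLp_one_iff_integrable.2 hf
  let g : C(Vec n, C(Vec n, Vec n)) :=
    (ContinuousMap.mk (fun p : Vec n × Vec n => p.2 - p.1) (by fun_prop)).curry
  have hg : ∀ h, MeasurePreserving (g h) (volume : Measure (Vec n)) volume := fun h =>
    measurePreserving_sub_right volume h
  have hc := Continuous.compMeasurePreservingLp (f := fun _ : Vec n => hL.toLp f)
    continuous_const g.continuous hg (by simp)
  have ht := (hc.edist (continuous_const (y := hL.toLp f))).tendsto 0
  have e : ∀ h, edist (Lp.compMeasurePreserving (g h) (hg h) (hL.toLp f)) (hL.toLp f)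
      = ∫⁻ y, ‖f (y - h) - f y‖ₑ := fun h => by
    rw [Lp.toLp_compMeasurePreserving, Lp.edist_toLp_toLp, eLpNorm_one_eq_lintegral_enorm]
    rfl
  simp only [e] at ht
  simpa using ht

/-- Approximate identity: the L¹ distance is at most the Gaussian average of the translation modulus
ω(√t z), which tends to zero by dominated convergence because ω ≤ 2‖f‖₁ and ω is continuous at 0. -/
lemma tendsto_eLpNorm_noisy_sub (hac : μ ≪ volume) (hμ : Integrable (fun x => ‖x‖ ^ 2) μ) :
    Tendsto (fun t => eLpNorm (noisy μ t - density μ) 1 volume) (𝓝[>] 0) (𝓝 0) := by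
  have hd := isDensity_density hac hμ
  set f := density μ
  have hfm := hd.measurable
  set ω : Vec n → ℝ≥0∞ := fun h => ∫⁻ y, ‖f (y - h) - f y‖ₑ with hω
  have hωm : Measurable ω := by
    have : Measurable (fun z : Vec n × Vec n => ‖f (z.2 - z.1) - f z.2‖ₑ) := by fun_prop
    exact this.lintegral_prod_right'
  have hω0 : Tendsto ω (𝓝 0) (𝓝 0) := tendsto_lintegral_enorm_translate_sub hd.integrable
  have hωb : ∀ h, ω h ≤ 2 * ∫⁻ y, ‖f y‖ₑ := fun h => by
    calc ω h ≤ ∫⁻ y, (‖f (y - h)‖ₑ + ‖f y‖ₑ) := lintegral_mono fun y => enorm_sub_le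
      _ = (∫⁻ y, ‖f (y - h)‖ₑ) + ∫⁻ y, ‖f y‖ₑ := lintegral_add_left (by fun_prop) _
      _ = 2 * ∫⁻ y, ‖f y‖ₑ := by
        rw [lintegral_sub_right_eq_self (fun y => ‖f y‖ₑ) h, two_mul]
  have hlim : Tendsto (fun t : ℝ => ∫⁻ z, ω (√t • z) ∂(stdGaussian (Vec n))) (𝓝[>] 0) (𝓝 0) := by
    have := tendsto_lintegral_filter_of_dominated_convergence (μ := stdGaussian (Vec n))
      (l := 𝓝[>] (0 : ℝ)) (F := fun t z => ω (√t • z)) (f := fun _ => 0)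
      (fun _ => 2 * ∫⁻ y, ‖f y‖ₑ)
      (Eventually.of_forall fun t => hωm.comp (by fun_prop))
      (Eventually.of_forall fun t => ae_of_all _ fun z => hωb _)
      (by
        rw [lintegral_const, measure_univ, mul_one]
        exact ENNReal.mul_ne_top (by simp) hd.integrable.2.ne)
      (ae_of_all _ fun z => hω0.comp (by
        have h1 : Continuous (fun t : ℝ => √t • z) := by fun_prop
        have h2 := h1.tendsto 0
        simp only [Real.sqrt_zero, zero_smul] at h2
        exact h2.mono_left nhdsWithin_le_nhds))
    simpa using this
  refine tendsto_of_tendsto_of_tendsto_of_le_of_le' tendsto_const_nhds hlim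
    (Eventually.of_forall fun _ => zero_le) ?_
  filter_upwards [self_mem_nhdsWithin] with t (ht : 0 < t)
  have hp := isProbabilityMeasure_heatMeasure (n := n) ht
  rw [eLpNorm_one_eq_lintegral_enorm]
  have hint : ∀ y, Integrable (fun u => f (y - u)) (heatMeasure t) := fun y => by
    rw [heatMeasure, integrable_withDensity_iff_integrable_smul' (by fun_prop) (by simp)]
    simp only [ENNReal.toReal_ofReal (heatKernel_pos t _).le, smul_eq_mul]
    obtain ⟨C, hC⟩ := (gaussianDecay_heatKernel (n := n) ht).exists_abs_le
    exact (hd.integrable.comp_sub_left y).bdd_mul (by fun_prop) (ae_of_all _ hC)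
  have hy : ∀ y, ‖(noisy μ t - f) y‖ₑ ≤ ∫⁻ u, ‖f (y - u) - f y‖ₑ ∂(heatMeasure t) := fun y => by
    have : (noisy μ t - f) y = ∫ u, (f (y - u) - f y) ∂(heatMeasure t) := by
      rw [integral_sub (hint y) (integrable_const _), Pi.sub_apply,
        noisy_eq_integral_density hac]
      simp [f]
    rw [this]
    exact enorm_integral_le_lintegral_enorm _
  calc ∫⁻ y, ‖(noisy μ t - f) y‖ₑ
      ≤ ∫⁻ y, ∫⁻ u, ‖f (y - u) - f y‖ₑ ∂(heatMeasure t) := lintegral_mono hy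
    _ = ∫⁻ u, ω u ∂(heatMeasure t) :=
        lintegral_lintegral_swap (by
          have : Measurable (fun z : Vec n × Vec n => ‖f (z.1 - z.2) - f z.1‖ₑ) := by fun_prop
          exact this.aemeasurable)
    _ = ∫⁻ z, ω (√t • z) ∂(stdGaussian (Vec n)) := by
        rw [← map_smul_stdGaussian ht, lintegral_map hωm (by fun_prop)]

/-- L¹ convergence gives a.e. convergence along subsequences, hence lower semicontinuity by Fatou.
Conversely, noise only raises the entropy, while it raises the cross entropy by t E‖Z‖² / 2, so the
relative entropy exceeds its limit by at most that amount. -/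
lemma tendsto_relEnt_noisy (hac : μ ≪ volume) (hμ : Integrable (fun x => ‖x‖ ^ 2) μ) :
    Tendsto (fun t => relEnt (noisy μ t)) (𝓝[>] 0) (𝓝 (relEnt (density μ))) := by
  have hd := isDensity_density hac hμ
  refine tendsto_of_subseq_tendsto fun ts hts => ?_
  have hpos : ∀ᶠ k in atTop, 0 < ts k := hts.eventually self_mem_nhdsWithin
  obtain ⟨N, hN⟩ := eventually_atTop.1 hpos
  -- Dropping the first N terms makes every noise variance positive, so each term is a genuine noisy
  -- density.
  set s : ℕ → ℝ := fun k => ts (k + N) with hs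
  have hs0 : ∀ k, 0 < s k := fun k => hN _ (by omega)
  have hst : Tendsto s atTop (𝓝[>] 0) := hts.comp (tendsto_add_atTop_nat N)
  have hmeas : TendstoInMeasure volume (fun k => noisy μ (s k)) atTop (density μ) :=
    tendstoInMeasure_of_tendsto_eLpNorm one_ne_zero
      (fun k => (continuous_noisy (hs0 k)).aestronglyMeasurable)
      hd.measurable.aestronglyMeasurable ((tendsto_eLpNorm_noisy_sub hac hμ).comp hst)
  obtain ⟨ns, hns, hae⟩ := hmeas.exists_seq_tendsto_ae
  refine ⟨fun k => ns k + N, ?_⟩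
  change Tendsto (fun k => relEnt (noisy μ (s (ns k)))) atTop _
  have hsn : Tendsto (fun k => s (ns k)) atTop (𝓝[>] 0) := hst.comp hns.tendsto_atTop
  refine tendsto_of_le_liminf_of_limsup_le ?_ ?_
  · calc relEnt (density μ)
        = ∫⁻ y, liminf (fun k => ENNReal.ofReal (klIntegrand (noisy μ (s (ns k))) y)) atTop := by
          refine lintegral_congr_ae ?_
          filter_upwards [hae] with y hy
          refine (Tendsto.liminf_eq ?_).symm
          refine ENNReal.tendsto_ofReal ?_
          unfold klIntegrand
          exact (((hy.mul_const _).neg.add_const _).sub hy).sub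
            ((Real.continuous_negMulLog.tendsto _).comp hy)
      _ ≤ liminf (fun k => relEnt (noisy μ (s (ns k)))) atTop :=
          lintegral_liminf_le fun k =>
            (isDensity_noisy hμ (hs0 _)).measurable_klIntegrand.ennreal_ofReal
  · by_cases htop : relEnt (density μ) = ∞
    · rw [htop]
      exact le_top
    have hi := hd.relEnt_ne_top_iff.1 htop
    have hle : ∀ k, relEnt (noisy μ (s (ns k))) ≤ relEnt (density μ) +
        ENNReal.ofReal (s (ns k) * gaussianMoment n / 2) := fun k => by
      have ht := hs0 (ns k)
      set t := s (ns k)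
      have hdn := isDensity_noisy hμ ht
      have h1 := hdn.integral_negMulLog (integrable_negMulLog_noisy hμ ht)
      have h2 := hd.integral_negMulLog hi
      have h3 := integral_negMulLog_density_le hac hμ ht hi
      have hne := hdn.relEnt_ne_top_iff.2 (integrable_negMulLog_noisy hμ ht)
      rw [noisyEntropy, h1, h2, crossEnt, crossEnt, integral_sq_mul_noisy hμ ht,
        integral_sq_mul_density hac] at h3
      rw [← ENNReal.ofReal_toReal hne, ← ENNReal.ofReal_toReal htop]
      refine (ENNReal.ofReal_le_ofReal ?_).trans ENNReal.ofReal_add_le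
      linarith
    have hlim : Tendsto (fun k => relEnt (density μ) +
        ENNReal.ofReal (s (ns k) * gaussianMoment n / 2)) atTop (𝓝 (relEnt (density μ))) := by
      have h0 : Tendsto (fun k => s (ns k) * gaussianMoment n / 2) atTop (𝓝 0) := by
        have := ((hsn.mono_right nhdsWithin_le_nhds).mul_const (gaussianMoment n)).div_const 2
        simpa using this
      have := tendsto_const_nhds (x := relEnt (density μ)).add (ENNReal.tendsto_ofReal h0)
      simpa using this
    calc limsup (fun k => relEnt (noisy μ (s (ns k)))) atTop
        ≤ limsup (fun k => relEnt (density μ) +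
            ENNReal.ofReal (s (ns k) * gaussianMoment n / 2)) atTop :=
          limsup_le_limsup (Eventually.of_forall hle)
      _ = relEnt (density μ) := hlim.limsup_eq

/-- The entropy of the noisy observation converges to that of the signal as the noise vanishes. -/
theorem tendsto_noisyEntropy (hac : μ ≪ volume) (hμ : Integrable (fun x => ‖x‖ ^ 2) μ) :
    Tendsto (fun t => (noisyEntropy μ t : EReal)) (𝓝[>] 0)
      (𝓝 ((entropyPos μ : EReal) - (entropyNeg μ : EReal))) := by
  have hd := isDensity_density hac hμ
  -- Entropy is cross entropy minus relative entropy. The cross entropies converge to a finite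
  -- value, so the difference is continuous even when the relative entropy is infinite.
  have hlim : (entropyPos μ : EReal) - (entropyNeg μ : EReal) =
      (crossEnt (density μ) : EReal) - (relEnt (density μ) : EReal) :=
    hd.lintegral_sub_lintegral_eq
  rw [hlim]
  have hev : ∀ᶠ t in 𝓝[>] (0 : ℝ), (crossEnt (noisy μ t) : EReal) +
      -(relEnt (noisy μ t) : EReal) = (noisyEntropy μ t : EReal) := by
    filter_upwards [self_mem_nhdsWithin] with t (ht : 0 < t)
    have hdn := isDensity_noisy hμ ht
    have h1 := hdn.integral_negMulLog (integrable_negMulLog_noisy hμ ht)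
    have hne := hdn.relEnt_ne_top_iff.2 (integrable_negMulLog_noisy hμ ht)
    rw [noisyEntropy, h1]
    lift relEnt (noisy μ t) to NNReal using hne with d
    simp only [ENNReal.coe_toReal]
    change (crossEnt (noisy μ t) : EReal) + -((d : ℝ) : EReal) = _
    rw [EReal.coe_sub]
    rfl
  refine Tendsto.congr' hev ?_
  have h1 : Tendsto (fun t => (crossEnt (noisy μ t) : EReal)) (𝓝[>] 0)
      (𝓝 (crossEnt (density μ) : EReal)) := by
    refine (continuous_coe_real_ereal.tendsto _).comp ?_
    have h2 : Tendsto (fun t : ℝ => n / 2 * Real.log (2 * Real.pi) +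
        (∫ x, ‖x‖ ^ 2 ∂μ + t * gaussianMoment n) / 2) (𝓝[>] 0) (𝓝 (crossEnt (density μ))) := by
      have hc : Continuous (fun t : ℝ => n / 2 * Real.log (2 * Real.pi) +
        (∫ x, ‖x‖ ^ 2 ∂μ + t * gaussianMoment n) / 2) := by fun_prop
      have := (hc.tendsto 0).mono_left (nhdsWithin_le_nhds (s := Ioi (0 : ℝ)))
      rw [zero_mul, add_zero] at this
      rwa [crossEnt, integral_sq_mul_density hac]
    refine h2.congr' ?_
    filter_upwards [self_mem_nhdsWithin] with t (ht : 0 < t)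
    rw [crossEnt, integral_sq_mul_noisy hμ ht]
  have h2 : Tendsto (fun t => -(relEnt (noisy μ t) : EReal)) (𝓝[>] 0)
      (𝓝 (-(relEnt (density μ) : EReal))) :=
    (((continuous_coe_ennreal_ereal).tendsto _).comp (tendsto_relEnt_noisy hac hμ)).neg
  have hadd := EReal.continuousAt_add
    (p := ((crossEnt (density μ) : EReal), -(relEnt (density μ) : EReal)))
    (Or.inl (EReal.coe_ne_top _)) (Or.inl (EReal.coe_ne_bot _))
  exact hadd.tendsto.comp (h1.prodMk_nhds h2)

end Noisy

end EPI

namespace EPI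

/-! ### Conditional expectations -/

/-- Rescaling or swapping observations loses no information; this replaces √γ X + Z by X + Z/√γ in
the conditioning. -/
lemma comap_comp_measurableEquiv {Ω F F' : Type*} [MeasurableSpace F] [MeasurableSpace F']
    (e : F ≃ᵐ F') (V : Ω → F) :
    MeasurableSpace.comap (fun ω => e (V ω)) inferInstance =
      MeasurableSpace.comap V inferInstance := by
  have h := congrArg (MeasurableSpace.comap V) e.measurableEmbedding.comap_eq
  rw [MeasurableSpace.comap_comp] at h
  exact h

section CondExp

variable {Ω : Type*} [m0 : MeasurableSpace Ω] {P : Measure Ω}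

/-- The joint law is a product, so Fubini slices the event by the value of R. This reduces
conditioning on a pair to conditioning on one component with the other frozen. -/
lemma setIntegral_eq_integral_of_indepFun [IsProbabilityMeasure P] {S F E : Type*} [MeasurableSpace S]
    [MeasurableSpace F] [NormedAddCommGroup E] [NormedSpace ℝ E] {T : Ω → S} {R : Ω → F}
    (hT : Measurable T) (hR : Measurable R) (hTR : IndepFun T R P) {h : S → E}
    (hh : StronglyMeasurable h) (hi : Integrable (fun ω => h (T ω)) P) {A : Set (S × F)}
    (hA : MeasurableSet A) :
    ∫ ω in (fun ω => (T ω, R ω)) ⁻¹' A, h (T ω) ∂P =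
      ∫ r, (∫ ω in T ⁻¹' ((fun s => (s, r)) ⁻¹' A), h (T ω) ∂P) ∂(P.map R) := by
  have : IsProbabilityMeasure (P.map T) := Measure.isProbabilityMeasure_map hT.aemeasurable
  have : IsProbabilityMeasure (P.map R) := Measure.isProbabilityMeasure_map hR.aemeasurable
  have hsm : StronglyMeasurable (A.indicator fun z : S × F => h z.1) :=
    (hh.comp_measurable measurable_fst).indicator hA
  have hmap := (indepFun_iff_map_prod_eq_prod_map_map hT.aemeasurable hR.aemeasurable).1 hTR
  have hint : Integrable (A.indicator fun z : S × F => h z.1) ((P.map T).prod (P.map R)) := by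
    refine Integrable.indicator ?_ hA
    exact ((integrable_map_measure hh.aestronglyMeasurable hT.aemeasurable).2 hi).comp_fst _
  rw [← integral_indicator ((hT.prodMk hR) hA)]
  have e1 : ∀ ω, ((fun ω => (T ω, R ω)) ⁻¹' A).indicator (fun ω => h (T ω)) ω =
      A.indicator (fun z : S × F => h z.1) (T ω, R ω) := fun ω => rfl
  simp_rw [e1]
  rw [← integral_map (hT.prodMk hR).aemeasurable hsm.aestronglyMeasurable, hmap,
    integral_prod_symm _ hint]
  refine integral_congr_ae (ae_of_all _ fun r => ?_)
  have hr : MeasurableSet ((fun s => (s, r)) ⁻¹' A : Set S) := measurable_prodMk_right hA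
  simp only
  rw [← integral_indicator (hT hr)]
  exact integral_map (f := fun x => A.indicator (fun z : S × F => h z.1) (x, r)) hT.aemeasurable
    (hsm.comp_measurable measurable_prodMk_right).aestronglyMeasurable

/-- Conditioning on an additional variable that is independent of everything else changes
nothing. -/
lemma condExp_prodMk_ae_eq_of_indepFun [IsProbabilityMeasure P] {F F' : Type*} [MeasurableSpace F] [MeasurableSpace F']
    {n : ℕ} {U : Ω → Vec n} {V : Ω → F} {R : Ω → F'} (hU : Measurable U) (hV : Measurable V)
    (hR : Measurable R) (hUi : Integrable U P) (hind : IndepFun (fun ω => (U ω, V ω)) R P) :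
    P[U | MeasurableSpace.comap (fun ω => (V ω, R ω)) inferInstance] =ᵐ[P]
      P[U | MeasurableSpace.comap V inferInstance] := by
  obtain ⟨g, hg, hgV⟩ := Measurable.exists_eq_measurable_comp (f := V)
    (g := P[U | MeasurableSpace.comap V inferInstance]) stronglyMeasurable_condExp.measurable
  have hle : MeasurableSpace.comap (fun ω => (V ω, R ω)) inferInstance ≤ m0 :=
    (hV.prodMk hR).comap_le
  have hgi : Integrable (fun ω => g (V ω)) P := by
    have := integrable_condExp (μ := P) (f := U) (m := MeasurableSpace.comap V inferInstance)
    rwa [hgV] at this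
  have hUV : Measurable (fun ω => (U ω, V ω)) := hU.prodMk hV
  rw [hgV]
  refine (ae_eq_condExp_of_forall_setIntegral_eq hle hUi (fun s _ _ => hgi.integrableOn) ?_
    ?_).symm
  · rintro s ⟨A, hA, rfl⟩ -
    have hB : MeasurableSet ((fun z : (Vec n × F) × F' => (z.1.2, z.2)) ⁻¹' A) :=
      ((measurable_snd.comp measurable_fst).prodMk measurable_snd) hA
    have h1 := setIntegral_eq_integral_of_indepFun (h := fun z : Vec n × F => g z.2) hUV hR hind
      (hg.comp measurable_snd).stronglyMeasurable hgi hB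
    have h2 := setIntegral_eq_integral_of_indepFun (h := fun z : Vec n × F => z.1) hUV hR hind
      measurable_fst.stronglyMeasurable hUi hB
    refine h1.trans (Eq.trans ?_ h2.symm)
    refine integral_congr_ae (ae_of_all _ fun r => ?_)
    have hr : MeasurableSet ((fun s => (s, r)) ⁻¹' A : Set F) := measurable_prodMk_right hA
    -- For frozen r the slice is an event of the σ-algebra of V, on which U and its conditional
    -- expectation have equal integrals.
    have h3 := setIntegral_condExp (μ := P) hV.comap_le hUi
      (s := V ⁻¹' ((fun s => (s, r)) ⁻¹' A)) ⟨_, hr, rfl⟩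
    rw [hgV] at h3
    exact h3
  · have hc : Measurable[MeasurableSpace.comap (fun ω => (V ω, R ω)) inferInstance]
        (fun ω => (V ω, R ω)) := comap_measurable _
    exact (hg.comp (measurable_fst.comp hc)).stronglyMeasurable.aestronglyMeasurable

lemma integrable_inner {n : ℕ} {U V : Ω → Vec n} (hU : MemLp U 2 P) (hV : MemLp V 2 P) :
    Integrable (fun ω => inner ℝ (U ω) (V ω)) P := by
  refine Integrable.mono' ((hU.integrable_norm_pow (by norm_num)).add
    (hV.integrable_norm_pow (by norm_num))) (hU.1.inner hV.1) (ae_of_all _ fun ω => ?_)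
  have := norm_inner_le_norm (𝕜 := ℝ) (U ω) (V ω)
  simp only [Pi.add_apply]
  nlinarith [sq_nonneg (‖U ω‖ - ‖V ω‖), sq_nonneg ‖U ω‖, sq_nonneg ‖V ω‖]

/-- Pythagoras for nested conditional expectations. -/
lemma integral_sq_norm_condExp_sub [IsProbabilityMeasure P] {n : ℕ} {U : Ω → Vec n}
    (hU : MemLp U 2 P) {m₁ m₂ : MeasurableSpace Ω} (h12 : m₁ ≤ m₂) (h2 : m₂ ≤ m0) :
    ∫ ω, ‖(P[U | m₂]) ω - (P[U | m₁]) ω‖ ^ 2 ∂P =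
      ∫ ω, ‖(P[U | m₂]) ω‖ ^ 2 ∂P - ∫ ω, ‖(P[U | m₁]) ω‖ ^ 2 ∂P := by
  have hA : MemLp (P[U | m₂]) 2 P := hU.condExp one_le_two
  have hB : MemLp (P[U | m₁]) 2 P := hU.condExp one_le_two
  have iA := hA.integrable_norm_pow (by norm_num)
  have iB := hB.integrable_norm_pow (by norm_num)
  have iAB : Integrable (fun ω => inner ℝ ((P[U | m₂]) ω) ((P[U | m₁]) ω)) P :=
    integrable_inner (m0 := m0) hA hB
  -- Conditioning the inner product on the coarser σ-algebra pulls out its measurable factor, and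
  -- the tower property collapses the other.
  have key : ∫ ω, inner ℝ ((P[U | m₂]) ω) ((P[U | m₁]) ω) ∂P = ∫ ω, ‖(P[U | m₁]) ω‖ ^ 2 ∂P := by
    rw [← integral_condExp (h12.trans h2)]
    refine integral_congr_ae ?_
    have h3 := condExp_bilin_of_stronglyMeasurable_right (μ := P) (m := m₁) (innerSL ℝ)
      (f := P[U | m₂]) (g := P[U | m₁]) stronglyMeasurable_condExp iAB
      (hA.integrable one_le_two)
    filter_upwards [h3, condExp_condExp_of_le (f := U) (μ := P) h12 h2] with ω h4 h5
    refine h4.trans ?_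
    rw [h5, innerSL_apply_apply, real_inner_self_eq_norm_sq]
  have e : ∀ ω, ‖(P[U | m₂]) ω - (P[U | m₁]) ω‖ ^ 2 = ‖(P[U | m₂]) ω‖ ^ 2 -
      2 * inner ℝ ((P[U | m₂]) ω) ((P[U | m₁]) ω) + ‖(P[U | m₁]) ω‖ ^ 2 := fun ω =>
    norm_sub_sq_real _ _
  simp_rw [e]
  have i1 : Integrable (fun ω => 2 * inner ℝ ((P[U | m₂]) ω) ((P[U | m₁]) ω)) P :=
    iAB.const_mul 2
  have i2 : Integrable (fun ω => ‖(P[U | m₂]) ω‖ ^ 2 -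
    2 * inner ℝ ((P[U | m₂]) ω) ((P[U | m₁]) ω)) P := iA.sub i1
  rw [integral_add i2 iB, integral_sub iA i1, integral_const_mul, key]
  ring

lemma lintegral_enorm_sq_eq {n : ℕ} {D : Ω → Vec n} (hD : MemLp D 2 P) :
    ∫⁻ ω, ‖D ω‖ₑ ^ 2 ∂P = ENNReal.ofReal (∫ ω, ‖D ω‖ ^ 2 ∂P) := by
  rw [ofReal_integral_eq_lintegral_ofReal (hD.integrable_norm_pow (by norm_num))
    (ae_of_all _ fun ω => by positivity)]
  refine lintegral_congr fun ω => ?_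
  rw [ENNReal.ofReal_pow (norm_nonneg _), ofReal_norm]

end CondExp

/-! ### Laws of mixtures -/

section Mix

variable {n : ℕ} {Ω : Type*} [MeasurableSpace Ω] {P : Measure Ω} {U V : Ω → Vec n} {α : ℝ}

lemma measurable_mix (hU : Measurable U) (hV : Measurable V) : Measurable (mix α U V) := by
  unfold mix
  fun_prop

lemma memLp_mix (hU : MemLp U 2 P) (hV : MemLp V 2 P) : MemLp (mix α U V) 2 P :=
  (hU.const_smul (√(1 - α))).add (hV.const_smul (√α))

lemma map_smul_absolutelyContinuous (hU : Measurable U) (hac : P.map U ≪ volume) {c : ℝ}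
    (hc : c ≠ 0) : P.map (fun ω => c • U ω) ≪ volume := by
  have h1 : P.map (fun ω => c • U ω) = (P.map U).map (fun x => c • x) :=
    (Measure.map_map (by fun_prop) hU).symm
  rw [h1]
  refine (hac.map (by fun_prop)).trans ?_
  rw [Measure.map_addHaar_smul volume hc]
  exact Measure.smul_absolutelyContinuous

/-- Convolution with any probability law preserves absolute continuity, so one summand with a
nonzero coefficient suffices: U when α = 0, and V otherwise. -/
lemma map_mix_absolutelyContinuous [IsProbabilityMeasure P] (hα : α ∈ Icc (0 : ℝ) 1) (hU : Measurable U)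
    (hV : Measurable V) (hUV : IndepFun U V P) (hacU : P.map U ≪ volume)
    (hacV : P.map V ≪ volume) : P.map (mix α U V) ≪ volume := by
  have hmU : Measurable (fun ω => √(1 - α) • U ω) := by fun_prop
  have hmV : Measurable (fun ω => √α • V ω) := by fun_prop
  have hind : IndepFun (fun ω => √(1 - α) • U ω) (fun ω => √α • V ω) P :=
    hUV.comp (φ := fun x => √(1 - α) • x) (ψ := fun x => √α • x) (by fun_prop) (by fun_prop)
  have : IsProbabilityMeasure (P.map fun ω => √(1 - α) • U ω) :=
    Measure.isProbabilityMeasure_map hmU.aemeasurable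
  have : IsProbabilityMeasure (P.map fun ω => √α • V ω) :=
    Measure.isProbabilityMeasure_map hmV.aemeasurable
  rcases hα.1.eq_or_lt with h | h
  · have e : mix α U V = (fun ω => √α • V ω) + fun ω => √(1 - α) • U ω := by
      ext1 ω
      exact add_comm _ _
    rw [e, hind.symm.map_add_eq_map_conv_map hmV hmU]
    exact Measure.conv_absolutelyContinuous
      (map_smul_absolutelyContinuous hU hacU (by simp [← h]))
  · have e : mix α U V = (fun ω => √(1 - α) • U ω) + fun ω => √α • V ω := rfl
    rw [e, hind.map_add_eq_map_conv_map hmU hmV]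
    exact Measure.conv_absolutelyContinuous
      (map_smul_absolutelyContinuous hV hacV (Real.sqrt_pos.2 h).ne')

lemma map_mix_stdGaussian [IsProbabilityMeasure P] (hα : α ∈ Icc (0 : ℝ) 1) (hU : Measurable U)
    (hV : Measurable V) (hUV : IndepFun U V P) (hGU : P.map U = stdGaussian (Vec n))
    (hGV : P.map V = stdGaussian (Vec n)) : P.map (mix α U V) = stdGaussian (Vec n) := by
  have hmU : Measurable (fun ω => √(1 - α) • U ω) := by fun_prop
  have hmV : Measurable (fun ω => √α • V ω) := by fun_prop
  have hind : IndepFun (fun ω => √(1 - α) • U ω) (fun ω => √α • V ω) P :=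
    hUV.comp (φ := fun x => √(1 - α) • x) (ψ := fun x => √α • x) (by fun_prop) (by fun_prop)
  have : IsProbabilityMeasure (P.map (mix α U V)) :=
    Measure.isProbabilityMeasure_map (measurable_mix hU hV).aemeasurable
  refine Measure.ext_of_charFun (funext fun s => ?_)
  have e : mix α U V = (fun ω => √(1 - α) • U ω) + fun ω => √α • V ω := rfl
  rw [e, hind.charFun_map_add_eq_mul hmU.aemeasurable hmV.aemeasurable, Pi.mul_apply,
    charFun_map_smul_comp hU.aemeasurable, charFun_map_smul_comp hV.aemeasurable, hGU, hGV,
    charFun_stdGaussian, charFun_stdGaussian, charFun_stdGaussian, ← Complex.exp_add]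
  congr 1
  have h1 : ‖√(1 - α) • s‖ ^ 2 + ‖√α • s‖ ^ 2 = ‖s‖ ^ 2 := by
    rw [norm_smul, norm_smul, mul_pow, mul_pow, Real.norm_eq_abs, Real.norm_eq_abs, sq_abs, sq_abs,
      Real.sq_sqrt (by linarith [hα.2]), Real.sq_sqrt hα.1]
    ring
  rw [← add_div, ← neg_add]
  congr 2
  exact_mod_cast h1

lemma map_smul_eq_heatMeasure {Z : Ω → Vec n} (hZ : Measurable Z)
    (hG : P.map Z = stdGaussian (Vec n)) {t : ℝ} (ht : 0 < t) :
    P.map (fun ω => √t • Z ω) = heatMeasure t := by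
  rw [← map_smul_stdGaussian ht, ← hG, Measure.map_map (by fun_prop) hZ]
  rfl

lemma memLp_of_map_eq_stdGaussian {Z : Ω → Vec n} (hZ : Measurable Z)
    (hG : P.map Z = stdGaussian (Vec n)) : MemLp Z 2 P := by
  have h : MemLp id 2 (stdGaussian (Vec n)) := IsGaussian.memLp_two_id
  rw [← hG] at h
  exact (memLp_map_measure_iff aestronglyMeasurable_id hZ.aemeasurable).1 h

end Mix

end EPI

-- The estimation gap as a difference of noise energies.

namespace EPI

/-- Two independent signals with finite second moments and two standard Gaussian noises, all
mutually independent. -/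
structure GaussianChannels {n : ℕ} {Ω : Type*} [MeasurableSpace Ω] (P : Measure Ω)
    (X₁ X₂ Z₁ Z₂ : Ω → Vec n) : Prop where
  measurable_X₁ : Measurable X₁
  measurable_X₂ : Measurable X₂
  measurable_Z₁ : Measurable Z₁
  measurable_Z₂ : Measurable Z₂
  memLp_X₁ : MemLp X₁ 2 P
  memLp_X₂ : MemLp X₂ 2 P
  map_Z₁ : P.map Z₁ = stdGaussian (Vec n)
  map_Z₂ : P.map Z₂ = stdGaussian (Vec n)
  indep : iIndepFun ![X₁, X₂, Z₁, Z₂] P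

/-- The difference of the noise energies of the components and of the mixture at signal-to-noise
ratio `γ`. -/
def energyGap {n : ℕ} {Ω : Type*} [MeasurableSpace Ω] (P : Measure Ω) (X₁ X₂ : Ω → Vec n)
    (α γ : ℝ) : ℝ :=
  (1 - α) * noiseEnergy (P.map X₁) γ⁻¹ + α * noiseEnergy (P.map X₂) γ⁻¹ -
    noiseEnergy (P.map (mix α X₁ X₂)) γ⁻¹

namespace GaussianChannels

variable {n : ℕ} {Ω : Type*} [MeasurableSpace Ω] {P : Measure Ω}
  {X₁ X₂ Z₁ Z₂ : Ω → Vec n} (h : GaussianChannels P X₁ X₂ Z₁ Z₂)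
include h

lemma measurable_family : ∀ i : Fin 4, Measurable (![X₁, X₂, Z₁, Z₂] i) := by
  intro i
  fin_cases i
  exacts [h.measurable_X₁, h.measurable_X₂, h.measurable_Z₁, h.measurable_Z₂]

lemma indep_signals_noises : IndepFun (fun ω => (X₁ ω, X₂ ω)) (fun ω => (Z₁ ω, Z₂ ω)) P :=
  h.indep.indepFun_prodMk_prodMk h.measurable_family 0 1 2 3 (by decide) (by decide) (by decide)
    (by decide)

lemma indep_channels : IndepFun (fun ω => (X₁ ω, Z₁ ω)) (fun ω => (X₂ ω, Z₂ ω)) P :=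
  h.indep.indepFun_prodMk_prodMk h.measurable_family 0 2 1 3 (by decide) (by decide) (by decide)
    (by decide)

end GaussianChannels

section Single

variable {n : ℕ} {Ω : Type*} [MeasurableSpace Ω] {P : Measure Ω} {X Z : Ω → Vec n}

lemma integral_smul_eq_zero (hZ : Measurable Z) (hG : P.map Z = stdGaussian (Vec n)) (c : ℝ) :
    ∫ ω, c • Z ω ∂P = 0 := by
  have h := integral_map (μ := P) hZ.aemeasurable (f := fun z : Vec n => z)
    aestronglyMeasurable_id
  rw [hG, integral_id_stdGaussian] at h
  rw [integral_smul, ← h, smul_zero]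

lemma integral_sq_norm_condExp_noise [IsProbabilityMeasure P] {W : Ω → Vec n} {t : ℝ} (hX : Measurable X)
    (hW : Measurable W) (hXW : IndepFun X W P) (hlaw : P.map W = heatMeasure t) (ht : 0 < t)
    (hX2 : MemLp X 2 P) (hW1 : Integrable W P) :
    ∫ ω, ‖(P[W | MeasurableSpace.comap (fun ω => X ω + W ω) inferInstance]) ω‖ ^ 2 ∂P =
      noiseEnergy (P.map X) t := by
  rw [← (integral_sq_norm_noiseMean_comp hX hW hXW hlaw ht hX2).2]
  refine integral_congr_ae ?_
  filter_upwards [condExp_noise_ae_eq hX hW hXW hlaw ht hX2 hW1] with ω hω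
  rw [hω]

/-- Estimating the signal `X` or the noise `W` from data determining `X + W` is equivalent. -/
lemma lintegral_condExp_signal_sub {Ω : Type*} {m0 : MeasurableSpace Ω} {P : Measure Ω}
    [IsProbabilityMeasure P] {X W : Ω → Vec n} (hX : MemLp X 2 P) (hW : MemLp W 2 P)
    {m₁ m₂ : MeasurableSpace Ω} (h12 : m₁ ≤ m₂) (h2 : m₂ ≤ m0)
    (hY : Measurable[m₁] fun ω => X ω + W ω) :
    0 ≤ ∫ ω, ‖(P[W | m₂]) ω‖ ^ 2 ∂P - ∫ ω, ‖(P[W | m₁]) ω‖ ^ 2 ∂P ∧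
      ∫⁻ ω, ‖(P[X | m₁]) ω - (P[X | m₂]) ω‖ₑ ^ 2 ∂P =
        ENNReal.ofReal (∫ ω, ‖(P[W | m₂]) ω‖ ^ 2 ∂P - ∫ ω, ‖(P[W | m₁]) ω‖ ^ 2 ∂P) := by
  have hYL : Integrable (fun ω => X ω + W ω) P := (hX.add hW).integrable one_le_two
  have iW : Integrable W P := hW.integrable one_le_two
  -- Once X + W is known, the estimates of X and W sum to it, so passing from X to W only flips the
  -- sign of the difference.
  have hXc : ∀ m' : MeasurableSpace Ω, m' ≤ m0 → Measurable[m'] (fun ω => X ω + W ω) →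
      P[X | m'] =ᵐ[P] fun ω => X ω + W ω - (P[W | m']) ω := fun m' hm' hY' => by
    have e : X = (fun ω => X ω + W ω) - W := by
      ext1 ω
      simp
    have h1 := condExp_sub hYL iW m'
    have h3 := condExp_of_stronglyMeasurable (μ := P) hm' hY'.stronglyMeasurable hYL
    rw [← e] at h1
    filter_upwards [h1] with ω hω
    rw [hω, Pi.sub_apply, h3]
  have hL : MemLp (fun ω => (P[W | m₂]) ω - (P[W | m₁]) ω) 2 P :=
    (hW.condExp one_le_two).sub (hW.condExp one_le_two)
  rw [← integral_sq_norm_condExp_sub (m0 := m0) hW h12 h2,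
    ← lintegral_enorm_sq_eq (m0 := m0) hL]
  refine ⟨integral_nonneg fun ω => by positivity, lintegral_congr_ae ?_⟩
  filter_upwards [hXc m₁ (h12.trans h2) hY, hXc m₂ h2 (hY.mono h12 le_rfl)] with ω h3 h4
  rw [h3, h4, sub_sub_sub_cancel_left]

end Single

namespace GaussianChannels

variable {n : ℕ} {Ω : Type*} [MeasurableSpace Ω] {P : Measure Ω} [IsProbabilityMeasure P]
  {X₁ X₂ Z₁ Z₂ : Ω → Vec n} (h : GaussianChannels P X₁ X₂ Z₁ Z₂)
include h

/-- The second moment of the conditional mean of the mixed noise, given both observations. -/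
lemma integral_sq_norm_condExp_mix {α t : ℝ} (hα : α ∈ Icc (0 : ℝ) 1) (ht : 0 < t) :
    ∫ ω, ‖(P[mix α (fun ω => √t • Z₁ ω) (fun ω => √t • Z₂ ω) | MeasurableSpace.comap
        (fun ω => (X₁ ω + √t • Z₁ ω, X₂ ω + √t • Z₂ ω)) inferInstance]) ω‖ ^ 2 ∂P =
      (1 - α) * noiseEnergy (P.map X₁) t + α * noiseEnergy (P.map X₂) t := by
  obtain ⟨hX₁, hX₂, hZ₁, hZ₂, hL₁, hL₂, hG₁, hG₂, hind⟩ := h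
  have h : GaussianChannels P X₁ X₂ Z₁ Z₂ := ⟨hX₁, hX₂, hZ₁, hZ₂, hL₁, hL₂, hG₁, hG₂, hind⟩
  set W₁ : Ω → Vec n := fun ω => √t • Z₁ ω with hW₁def
  set W₂ : Ω → Vec n := fun ω => √t • Z₂ ω with hW₂def
  have hW₁ : Measurable W₁ := by fun_prop
  have hW₂ : Measurable W₂ := by fun_prop
  have hlaw₁ : P.map W₁ = heatMeasure t := map_smul_eq_heatMeasure hZ₁ hG₁ ht
  have hlaw₂ : P.map W₂ = heatMeasure t := map_smul_eq_heatMeasure hZ₂ hG₂ ht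
  have iW₁ : Integrable W₁ P :=
    ((memLp_of_map_eq_stdGaussian hZ₁ hG₁).const_smul (√t)).integrable one_le_two
  have iW₂ : Integrable W₂ P :=
    ((memLp_of_map_eq_stdGaussian hZ₂ hG₂).const_smul (√t)).integrable one_le_two
  have hXW₁ : IndepFun X₁ W₁ P :=
    h.indep_signals_noises.comp (φ := Prod.fst) (ψ := fun z : Vec n × Vec n => √t • z.1) (by fun_prop)
      (by fun_prop)
  have hXW₂ : IndepFun X₂ W₂ P :=
    h.indep_signals_noises.comp (φ := Prod.snd) (ψ := fun z : Vec n × Vec n => √t • z.2) (by fun_prop)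
      (by fun_prop)
  have hV₁ : Measurable (fun ω => X₁ ω + W₁ ω) := by fun_prop
  have hV₂ : Measurable (fun ω => X₂ ω + W₂ ω) := by fun_prop
  have hI₁ : IndepFun (fun ω => (W₁ ω, X₁ ω + W₁ ω)) (fun ω => X₂ ω + W₂ ω) P :=
    h.indep_channels.comp (φ := fun z : Vec n × Vec n => (√t • z.2, z.1 + √t • z.2))
      (ψ := fun z : Vec n × Vec n => z.1 + √t • z.2) (by fun_prop) (by fun_prop)
  have hI₂ : IndepFun (fun ω => (W₂ ω, X₂ ω + W₂ ω)) (fun ω => X₁ ω + W₁ ω) P :=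
    h.indep_channels.symm.comp (φ := fun z : Vec n × Vec n => (√t • z.2, z.1 + √t • z.2))
      (ψ := fun z : Vec n × Vec n => z.1 + √t • z.2) (by fun_prop) (by fun_prop)
  set T₁ : Ω → Vec n := fun ω => noiseMean (P.map X₁) t (X₁ ω + W₁ ω) with hT₁def
  set T₂ : Ω → Vec n := fun ω => noiseMean (P.map X₂) t (X₂ ω + W₂ ω) with hT₂def
  have c₁ := condExp_noise_ae_eq hX₁ hW₁ hXW₁ hlaw₁ ht hL₁ iW₁
  have c₂ := condExp_noise_ae_eq hX₂ hW₂ hXW₂ hlaw₂ ht hL₂ iW₂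
  -- The second channel is independent of the first and carries no information on its noise.
  have hT₁ : P[W₁ | MeasurableSpace.comap (fun ω => (X₁ ω + W₁ ω, X₂ ω + W₂ ω)) inferInstance]
      =ᵐ[P] T₁ :=
    (condExp_prodMk_ae_eq_of_indepFun hW₁ hV₁ hV₂ iW₁ hI₁).trans c₁
  have hT₂ : P[W₂ | MeasurableSpace.comap (fun ω => (X₁ ω + W₁ ω, X₂ ω + W₂ ω)) inferInstance]
      =ᵐ[P] T₂ := by
    have hs := comap_comp_measurableEquiv (MeasurableEquiv.prodComm (α := Vec n) (β := Vec n))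
      (fun ω => (X₁ ω + W₁ ω, X₂ ω + W₂ ω))
    rw [← hs]
    exact (condExp_prodMk_ae_eq_of_indepFun hW₂ hV₂ hV₁ iW₂ hI₂).trans c₂
  obtain ⟨iT₁, eT₁⟩ := integral_sq_norm_noiseMean_comp hX₁ hW₁ hXW₁ hlaw₁ ht hL₁
  obtain ⟨iT₂, eT₂⟩ := integral_sq_norm_noiseMean_comp hX₂ hW₂ hXW₂ hlaw₂ ht hL₂
  have : IsProbabilityMeasure (P.map X₁) := Measure.isProbabilityMeasure_map hX₁.aemeasurable
  have : IsProbabilityMeasure (P.map X₂) := Measure.isProbabilityMeasure_map hX₂.aemeasurable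
  have mT₁ : Measurable T₁ := (measurable_noiseMean ht).comp hV₁
  have mT₂ : Measurable T₂ := (measurable_noiseMean ht).comp hV₂
  have L₁ : MemLp T₁ 2 P := (memLp_two_iff_integrable_sq_norm mT₁.aestronglyMeasurable).2 iT₁
  have L₂ : MemLp T₂ 2 P := (memLp_two_iff_integrable_sq_norm mT₂.aestronglyMeasurable).2 iT₂
  have hI : IndepFun T₁ T₂ P := by
    have hφ₁ := measurable_noiseMean (μ := P.map X₁) ht
    have hφ₂ := measurable_noiseMean (μ := P.map X₂) ht
    exact h.indep_channels.comp (φ := fun z : Vec n × Vec n => noiseMean (P.map X₁) t (z.1 + √t • z.2))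
      (ψ := fun z : Vec n × Vec n => noiseMean (P.map X₂) t (z.1 + √t • z.2)) (by fun_prop) (by fun_prop)
  -- With T₁ and T₂ independent, the vanishing of one mean already removes the cross term.
  have hmean : ∫ ω, T₁ ω ∂P = 0 := by
    rw [← integral_congr_ae c₁, integral_condExp hV₁.comap_le]
    exact integral_smul_eq_zero hZ₁ hG₁ _
  have hcross : ∫ ω, inner ℝ (T₁ ω) (T₂ ω) ∂P = 0 := by
    have := hI.integral_bilin (L₁.integrable one_le_two) (L₂.integrable one_le_two) (innerSL ℝ)
    rw [hmean, map_zero, zero_apply] at this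
    exact (integral_congr_ae (ae_of_all _ fun ω => (innerSL_apply_apply ℝ _ _).symm)).trans this
  have hsum : P[mix α W₁ W₂ | MeasurableSpace.comap (fun ω => (X₁ ω + W₁ ω, X₂ ω + W₂ ω)) inferInstance]
      =ᵐ[P] fun ω => √(1 - α) • T₁ ω + √α • T₂ ω := by
    have e : mix α W₁ W₂ = √(1 - α) • W₁ + √α • W₂ := rfl
    rw [e]
    filter_upwards [condExp_add (iW₁.smul (√(1 - α))) (iW₂.smul (√α)) _,
      condExp_smul (μ := P) (√(1 - α)) W₁ _, condExp_smul (μ := P) (√α) W₂ _, hT₁, hT₂]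
      with ω h1 h2 h3 h4 h5
    rw [h1, Pi.add_apply, h2, h3, Pi.smul_apply, Pi.smul_apply, h4, h5]
  have e2 : ∫ ω, ‖(P[mix α W₁ W₂ | MeasurableSpace.comap
      (fun ω => (X₁ ω + W₁ ω, X₂ ω + W₂ ω)) inferInstance]) ω‖ ^ 2 ∂P = ∫ ω, ((1 - α) * ‖T₁ ω‖ ^ 2 +
      2 * (√(1 - α) * √α) * inner ℝ (T₁ ω) (T₂ ω) + α * ‖T₂ ω‖ ^ 2) ∂P := by
    refine integral_congr_ae ?_
    filter_upwards [hsum] with ω hω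
    have s1 := Real.sq_sqrt (show 0 ≤ 1 - α by linarith [hα.2])
    have s2 := Real.sq_sqrt hα.1
    rw [hω, norm_add_sq_real, norm_smul, norm_smul, mul_pow, mul_pow, Real.norm_eq_abs,
      Real.norm_eq_abs, sq_abs, sq_abs, s1, s2, inner_smul_left, inner_smul_right]
    simp only [conj_trivial]
    ring
  have i1 : Integrable (fun ω => (1 - α) * ‖T₁ ω‖ ^ 2) P := iT₁.const_mul _
  have i2 : Integrable (fun ω => 2 * (√(1 - α) * √α) * inner ℝ (T₁ ω) (T₂ ω)) P :=
    (integrable_inner L₁ L₂).const_mul _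
  have i3 : Integrable (fun ω => α * ‖T₂ ω‖ ^ 2) P := iT₂.const_mul _
  have i12 : Integrable (fun ω => (1 - α) * ‖T₁ ω‖ ^ 2 +
      2 * (√(1 - α) * √α) * inner ℝ (T₁ ω) (T₂ ω)) P := i1.add i2
  rw [e2, integral_add i12 i3, integral_add i1 i2, integral_const_mul, integral_const_mul,
    integral_const_mul, hcross, eT₁, eT₂]
  ring

/-- Dividing the observations by √γ gives noise of variance 1/γ without changing the σ-algebras. The
signal may be replaced by the noise, Pythagoras gives a difference of energies, and each is a known
noise energy, the mixed noise being Gaussian of the same variance and independent of the mixed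
signal. -/
theorem estimationGap_eq {α γ : ℝ} (hα : α ∈ Icc (0 : ℝ) 1) (hγ : 0 < γ) :
    0 ≤ energyGap P X₁ X₂ α γ ∧
      estimationGap P X₁ X₂ Z₁ Z₂ α γ = ENNReal.ofReal (energyGap P X₁ X₂ α γ) := by
  have ht : 0 < γ⁻¹ := inv_pos.2 hγ
  have hmixE := h.integral_sq_norm_condExp_mix hα ht
  obtain ⟨hX₁, hX₂, hZ₁, hZ₂, hL₁, hL₂, hG₁, hG₂, hind⟩ := h
  have h : GaussianChannels P X₁ X₂ Z₁ Z₂ := ⟨hX₁, hX₂, hZ₁, hZ₂, hL₁, hL₂, hG₁, hG₂, hind⟩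
  unfold energyGap
  set t := γ⁻¹ with htdef
  -- This makes the coefficient of the noise 1 after factoring √γ out of the channel.
  have hst : √γ * √t = 1 := by
    rw [← Real.sqrt_mul hγ.le, htdef, mul_inv_cancel₀ hγ.ne', Real.sqrt_one]
  have hγ0 : √γ ≠ 0 := (Real.sqrt_pos.2 hγ).ne'
  set X := mix α X₁ X₂ with hXdef
  set W := mix α (fun ω => √t • Z₁ ω) (fun ω => √t • Z₂ ω) with hWdef
  have hX : Measurable X := measurable_mix hX₁ hX₂
  have hW : Measurable W := measurable_mix (by fun_prop) (by fun_prop)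
  have hXL : MemLp X 2 P := memLp_mix hL₁ hL₂
  have hWL : MemLp W 2 P := memLp_mix
    ((memLp_of_map_eq_stdGaussian hZ₁ hG₁).const_smul (√t))
    ((memLp_of_map_eq_stdGaussian hZ₂ hG₂).const_smul (√t))
  have hZ₁₂ : IndepFun Z₁ Z₂ P :=
    h.indep_channels.comp (φ := Prod.snd) (ψ := Prod.snd) measurable_snd measurable_snd
  have hWmix : W = fun ω => √t • mix α Z₁ Z₂ ω := by
    ext1 ω
    simp only [hWdef, mix, smul_add, smul_smul, mul_comm]
  have hlaw : P.map W = heatMeasure t := by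
    rw [hWmix]
    exact map_smul_eq_heatMeasure (measurable_mix hZ₁ hZ₂)
      (map_mix_stdGaussian hα hZ₁ hZ₂ hZ₁₂ hG₁ hG₂) ht
  have hXW : IndepFun X W P :=
    h.indep_signals_noises.comp (φ := fun z : Vec n × Vec n => √(1 - α) • z.1 + √α • z.2)
      (ψ := fun z : Vec n × Vec n => √(1 - α) • √t • z.1 + √α • √t • z.2) (by fun_prop)
      (by fun_prop)
  have hch : ∀ U Z : Ω → Vec n, channel γ U Z = fun ω => √γ • (U ω + √t • Z ω) := fun U Z => by
    ext1 ω
    simp only [channel, smul_add, smul_smul, hst, one_smul]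
  have em₁ : MeasurableSpace.comap (mix α (channel γ X₁ Z₁) (channel γ X₂ Z₂)) inferInstance
      = MeasurableSpace.comap (fun ω => X ω + W ω) inferInstance := by
    rw [← comap_comp_measurableEquiv (MeasurableEquiv.smul₀ (√γ) hγ0) (fun ω => X ω + W ω)]
    congr 1
    ext1 ω
    simp only [hch, mix, hXdef, hWdef, MeasurableEquiv.coe_smul₀]
    module
  have em₂ : MeasurableSpace.comap (fun ω' => (channel γ X₁ Z₁ ω', channel γ X₂ Z₂ ω'))
      inferInstance = MeasurableSpace.comap
        (fun ω => (X₁ ω + √t • Z₁ ω, X₂ ω + √t • Z₂ ω)) inferInstance := by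
    rw [← comap_comp_measurableEquiv ((MeasurableEquiv.smul₀ (√γ) hγ0).prodCongr
      (MeasurableEquiv.smul₀ (√γ) hγ0)) (fun ω => (X₁ ω + √t • Z₁ ω, X₂ ω + √t • Z₂ ω))]
    congr 1
    ext1 ω
    simp only [hch]
    rfl
  have hpair : Measurable (fun ω => (X₁ ω + √t • Z₁ ω, X₂ ω + √t • Z₂ ω)) := by fun_prop
  have hYpair : Measurable[MeasurableSpace.comap
      (fun ω => (X₁ ω + √t • Z₁ ω, X₂ ω + √t • Z₂ ω)) inferInstance] (fun ω => X ω + W ω) := by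
    have hg : Measurable (fun z : Vec n × Vec n => √(1 - α) • z.1 + √α • z.2) := by fun_prop
    have e : (fun ω => X ω + W ω) = (fun z : Vec n × Vec n => √(1 - α) • z.1 + √α • z.2) ∘
        fun ω => (X₁ ω + √t • Z₁ ω, X₂ ω + √t • Z₂ ω) := by
      ext1 ω
      simp only [hXdef, hWdef, mix, Function.comp_apply]
      module
    rw [e]
    exact hg.comp (comap_measurable _)
  have hmain := lintegral_condExp_signal_sub hXL hWL hYpair.comap_le hpair.comap_le
    (comap_measurable _)
  rw [hmixE, integral_sq_norm_condExp_noise hX hW hXW hlaw ht hXL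
    (hWL.integrable one_le_two)] at hmain
  unfold estimationGap condGiven
  rw [em₁, em₂]
  exact hmain

end GaussianChannels

end EPI

-- Integration over the signal-to-noise ratio.

namespace EPI

variable {n : ℕ}

/-- The normalised entropy of the heat flow converges to that of the Gaussian law. -/
lemma tendsto_noisyEntropy_atTop {μ : Measure (Vec n)} [IsProbabilityMeasure μ]
    (hμ : Integrable (fun x => ‖x‖ ^ 2) μ) :
    Tendsto (fun t => noisyEntropy μ t -
      (n / 2 * Real.log (2 * Real.pi * t) + gaussianMoment n / 2)) atTop (𝓝 0) := by
  have h0 : Tendsto (fun t : ℝ => (∫ x, ‖x‖ ^ 2 ∂μ) / (2 * t)) atTop (𝓝 0) :=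
    Tendsto.div_atTop tendsto_const_nhds (tendsto_id.const_mul_atTop two_pos)
  refine tendsto_of_tendsto_of_tendsto_of_le_of_le' tendsto_const_nhds h0 ?_ ?_ <;>
  · filter_upwards [eventually_gt_atTop 0] with t ht
    have := noisyEntropy_bounds hμ ht
    linarith [this.1, this.2]

/-- The entropy deficit of the mixture at signal-to-noise ratio `γ`. -/
def entropyDeficit {Ω : Type*} [MeasurableSpace Ω] (P : Measure Ω) (X₁ X₂ : Ω → Vec n)
    (α γ : ℝ) : ℝ :=
  noisyEntropy (P.map (mix α X₁ X₂)) γ⁻¹ -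
    ((1 - α) * noisyEntropy (P.map X₁) γ⁻¹ + α * noisyEntropy (P.map X₂) γ⁻¹)

section

variable {Ω : Type*} [MeasurableSpace Ω] {P : Measure Ω} [IsProbabilityMeasure P]
  {X₁ X₂ Z₁ Z₂ : Ω → Vec n} {α : ℝ}

/-- The derivative -γ⁻² of the noise variance cancels the 1/t² in de Bruijn's identity, which is why
γ is the natural parameter. -/
lemma hasDerivAt_noisyEntropy_inv {μ : Measure (Vec n)} [IsProbabilityMeasure μ]
    (hμ : Integrable (fun x => ‖x‖ ^ 2) μ) {γ : ℝ} (hγ : 0 < γ) :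
    HasDerivAt (fun γ => noisyEntropy μ γ⁻¹) (-(noiseEnergy μ γ⁻¹ / 2)) γ := by
  have h := (hasDerivAt_noisyEntropy hμ (inv_pos.2 hγ)).comp γ (hasDerivAt_inv hγ.ne')
  refine h.congr_deriv ?_
  field_simp

lemma GaussianChannels.hasDerivAt_entropyDeficit (h : GaussianChannels P X₁ X₂ Z₁ Z₂) {γ : ℝ}
    (hγ : 0 < γ) :
    HasDerivAt (entropyDeficit P X₁ X₂ α) (energyGap P X₁ X₂ α γ / 2) γ := by
  have hX := measurable_mix (α := α) h.measurable_X₁ h.measurable_X₂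
  have := Measure.isProbabilityMeasure_map (μ := P) h.measurable_X₁.aemeasurable
  have := Measure.isProbabilityMeasure_map (μ := P) h.measurable_X₂.aemeasurable
  have := Measure.isProbabilityMeasure_map (μ := P) hX.aemeasurable
  have d := hasDerivAt_noisyEntropy_inv
    (integrable_sq_norm_map hX (memLp_mix h.memLp_X₁ h.memLp_X₂)) hγ
  have d₁ := hasDerivAt_noisyEntropy_inv (integrable_sq_norm_map h.measurable_X₁ h.memLp_X₁) hγ
  have d₂ := hasDerivAt_noisyEntropy_inv (integrable_sq_norm_map h.measurable_X₂ h.memLp_X₂) hγ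
  refine (d.sub ((d₁.const_mul (1 - α)).add (d₂.const_mul α))).congr_deriv ?_
  rw [energyGap]
  ring

/-- The diverging Gaussian entropy enters the mixture with weight 1 and the components with total
weight (1 - α) + α = 1, so it cancels. -/
lemma GaussianChannels.tendsto_entropyDeficit_zero (h : GaussianChannels P X₁ X₂ Z₁ Z₂) :
    Tendsto (entropyDeficit P X₁ X₂ α) (𝓝[>] 0) (𝓝 0) := by
  have hX := measurable_mix (α := α) h.measurable_X₁ h.measurable_X₂
  have := Measure.isProbabilityMeasure_map (μ := P) h.measurable_X₁.aemeasurable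
  have := Measure.isProbabilityMeasure_map (μ := P) h.measurable_X₂.aemeasurable
  have := Measure.isProbabilityMeasure_map (μ := P) hX.aemeasurable
  have d := tendsto_noisyEntropy_atTop
    (integrable_sq_norm_map hX (memLp_mix h.memLp_X₁ h.memLp_X₂))
  have d₁ := tendsto_noisyEntropy_atTop (integrable_sq_norm_map h.measurable_X₁ h.memLp_X₁)
  have d₂ := tendsto_noisyEntropy_atTop (integrable_sq_norm_map h.measurable_X₂ h.memLp_X₂)
  have key := (d.sub ((d₁.const_mul (1 - α)).add (d₂.const_mul α))).comp
    tendsto_inv_nhdsGT_zero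
  simp only [mul_zero, add_zero, sub_zero] at key
  refine key.congr fun γ => ?_
  simp only [Function.comp_apply, entropyDeficit]
  ring

/-- The fundamental theorem of calculus; integrability of the derivative is automatic because it is
nonnegative. -/
lemma GaussianChannels.lintegral_Ioc_energyGap (h : GaussianChannels P X₁ X₂ Z₁ Z₂)
    (hα : α ∈ Icc (0 : ℝ) 1) {a b : ℝ} (ha : 0 < a) (hab : a ≤ b) :
    ∫⁻ γ in Ioc a b, ENNReal.ofReal (energyGap P X₁ X₂ α γ / 2) =
      ENNReal.ofReal (entropyDeficit P X₁ X₂ α b - entropyDeficit P X₁ X₂ α a) := by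
  have hd : ∀ γ ∈ Icc a b, HasDerivAt (entropyDeficit P X₁ X₂ α)
      (energyGap P X₁ X₂ α γ / 2) γ := fun γ hγ =>
    h.hasDerivAt_entropyDeficit (ha.trans_le hγ.1)
  have hc : ContinuousOn (entropyDeficit P X₁ X₂ α) (Icc a b) := fun γ hγ =>
    (hd γ hγ).continuousAt.continuousWithinAt
  have hpos : ∀ γ, 0 < γ → 0 ≤ energyGap P X₁ X₂ α γ / 2 := fun γ hγ =>
    div_nonneg (h.estimationGap_eq hα hγ).1 two_pos.le
  have hi := intervalIntegral.integrableOn_deriv_of_nonneg hc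
    (fun γ hγ => hd γ (Ioo_subset_Icc_self hγ)) (fun γ hγ => hpos γ (ha.trans hγ.1))
  rw [← intervalIntegral.integral_eq_sub_of_hasDerivAt_of_le hab hc
    (fun γ hγ => hd γ (Ioo_subset_Icc_self hγ))
    ((intervalIntegrable_iff_integrableOn_Ioc_of_le hab).2 hi),
    intervalIntegral.integral_of_le hab, ofReal_integral_eq_lintegral_ofReal hi]
  filter_upwards [ae_restrict_mem measurableSet_Ioc] with γ hγ
  exact hpos γ (ha.trans hγ.1)

lemma GaussianChannels.deficit_eq (h : GaussianChannels P X₁ X₂ Z₁ Z₂)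
    (hα : α ∈ Icc (0 : ℝ) 1) :
    deficit P X₁ X₂ Z₁ Z₂ α =
      ∫⁻ γ in Ioi (0 : ℝ), ENNReal.ofReal (energyGap P X₁ X₂ α γ / 2) := by
  rw [deficit, ← lintegral_const_mul' _ _ (by simp)]
  refine setLIntegral_congr_fun measurableSet_Ioi fun γ hγ => ?_
  rw [(h.estimationGap_eq hα hγ).2, div_eq_inv_mul, ENNReal.ofReal_mul (by norm_num),
    ENNReal.ofReal_inv_of_pos two_pos]
  simp

/-- The deficit is the limit of the entropy deficits at growing signal-to-noise ratio. -/
lemma GaussianChannels.tendsto_entropyDeficit (h : GaussianChannels P X₁ X₂ Z₁ Z₂)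
    (hα : α ∈ Icc (0 : ℝ) 1) :
    Tendsto (fun k : ℕ => ((entropyDeficit P X₁ X₂ α (k + 1) : ℝ) : EReal)) atTop
      (𝓝 (deficit P X₁ X₂ Z₁ Z₂ α : EReal)) := by
  set G := entropyDeficit P X₁ X₂ α
  have ha0 : ∀ k : ℕ, (0 : ℝ) < 1 / ((k : ℝ) + 1) := fun k => by positivity
  have hab : ∀ k : ℕ, 1 / ((k : ℝ) + 1) ≤ (k : ℝ) + 1 := fun k => by
    have hk : (1 : ℝ) ≤ (k : ℝ) + 1 := by linarith [(Nat.cast_nonneg k : (0 : ℝ) ≤ k)]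
    exact (div_le_one_of_le₀ hk (by positivity)).trans hk
  have hal : Tendsto (fun k : ℕ => 1 / ((k : ℝ) + 1)) atTop (𝓝 0) :=
    tendsto_one_div_add_atTop_nhds_zero_nat
  have hbl : Tendsto (fun k : ℕ => (k : ℝ) + 1) atTop atTop :=
    tendsto_atTop_add_const_right _ _ tendsto_natCast_atTop_atTop
  -- The half-line is exhausted by the intervals (1/(k+1), k+1], on which the integral is a
  -- difference of values of G.
  have hcover : AECover (volume.restrict (Ioi (0 : ℝ))) atTop
      (fun k : ℕ => Ioi (1 / ((k : ℝ) + 1)) ∩ Iic ((k : ℝ) + 1)) :=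
    (aecover_Ioi_of_Ioi hal).inter (aecover_Iic hbl)
  have hmeas : AEMeasurable (fun γ => ENNReal.ofReal (energyGap P X₁ X₂ α γ / 2))
      (volume.restrict (Ioi (0 : ℝ))) := by
    -- The integrand is measurable because it comes from a derivative.
    refine ((measurable_deriv G).ennreal_ofReal.aemeasurable).congr ?_
    filter_upwards [ae_restrict_mem measurableSet_Ioi] with γ hγ
    rw [(h.hasDerivAt_entropyDeficit hγ).deriv]
  have hlim := hcover.lintegral_tendsto_of_countably_generated hmeas
  rw [← h.deficit_eq hα] at hlim
  have hval : ∀ k : ℕ, ∫⁻ γ in Ioi (1 / ((k : ℝ) + 1)) ∩ Iic ((k : ℝ) + 1),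
      ENNReal.ofReal (energyGap P X₁ X₂ α γ / 2) ∂(volume.restrict (Ioi (0 : ℝ))) =
      ENNReal.ofReal (G (k + 1) - G (1 / (k + 1))) := fun k => by
    rw [← h.lintegral_Ioc_energyGap hα (ha0 k) (hab k),
      Measure.restrict_restrict (measurableSet_Ioi.inter measurableSet_Iic)]
    congr 2
    ext x
    simp only [mem_inter_iff, mem_Ioi, mem_Iic, mem_Ioc]
    exact ⟨fun hx => hx.1, fun hx => ⟨hx, (ha0 k).trans hx.1⟩⟩
  simp_rw [hval] at hlim
  -- Nonnegativity ensures that `ENNReal.ofReal` truncates nothing when the difference is read back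
  -- as an extended real.
  have hmono : ∀ k : ℕ, 0 ≤ G (k + 1) - G (1 / (k + 1)) := fun k => by
    have hm : MonotoneOn G (Ioi 0) := by
      refine monotoneOn_of_deriv_nonneg (convex_Ioi 0)
        (fun γ hγ => (h.hasDerivAt_entropyDeficit hγ).continuousAt.continuousWithinAt)
        (fun γ hγ => (h.hasDerivAt_entropyDeficit
          (interior_subset hγ)).differentiableAt.differentiableWithinAt) fun γ hγ => ?_
      have hγ' : γ ∈ Ioi (0 : ℝ) := interior_subset hγ
      rw [(h.hasDerivAt_entropyDeficit hγ').deriv]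
      exact div_nonneg (h.estimationGap_eq hα hγ').1 two_pos.le
    exact sub_nonneg.2 (hm (ha0 k) ((ha0 k).trans_le (hab k)) (hab k))
  have h1 := ((continuous_coe_ennreal_ereal).tendsto _).comp hlim
  have h2 : Tendsto (fun k : ℕ => ((G (1 / ((k : ℝ) + 1)) : ℝ) : EReal)) atTop
      (𝓝 ((0 : ℝ) : EReal)) := by
    refine (continuous_coe_real_ereal.tendsto _).comp (h.tendsto_entropyDeficit_zero.comp ?_)
    exact tendsto_nhdsWithin_iff.2 ⟨hal, Eventually.of_forall ha0⟩
  have hadd := (EReal.continuousAt_add (p := ((deficit P X₁ X₂ Z₁ Z₂ α : EReal), ((0 : ℝ) : EReal)))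
    (Or.inr (EReal.coe_ne_bot _)) (Or.inr (EReal.coe_ne_top _))).tendsto.comp
    (h1.prodMk_nhds h2)
  simp only [EReal.coe_zero, add_zero] at hadd
  refine hadd.congr fun k => ?_
  simp only [Function.comp_apply]
  rw [EReal.coe_ennreal_ofReal, max_eq_left (hmono k), ← EReal.coe_add]
  congr 1
  ring

end

/-- A real multiple of a convergent sequence converges in `EReal`, with `0 * ⊥ = 0`. -/
lemma tendsto_coe_mul {ι : Type*} {l : Filter ι} {u : ι → ℝ} {e : EReal} (c : ℝ)
    (hu : Tendsto (fun i => (u i : EReal)) l (𝓝 e)) :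
    Tendsto (fun i => ((c * u i : ℝ) : EReal)) l (𝓝 ((c : EReal) * e)) := by
  -- Multiplication of extended reals is discontinuous at 0 times infinity, but for c = 0 the
  -- sequence is constant.
  rcases eq_or_ne c 0 with rfl | hc
  · simpa using tendsto_const_nhds
  · have h0 : (c : EReal) ≠ 0 := by exact_mod_cast hc
    have h := (EReal.continuousAt_mul (p := ((c : EReal), e)) (Or.inl h0) (Or.inl h0)
      (Or.inl (EReal.coe_ne_bot c)) (Or.inl (EReal.coe_ne_top c))).tendsto.comp
      (tendsto_const_nhds.prodMk_nhds hu)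
    simp only [EReal.coe_mul]
    exact h

lemma coe_mul_ne_top {c : ℝ} (hc : 0 ≤ c) {e : EReal} (he : e ≠ ⊤) : (c : EReal) * e ≠ ⊤ := by
  induction e with
  | bot =>
    rcases hc.eq_or_lt with rfl | hc
    · simp
    · simp [EReal.coe_mul_bot_of_pos hc]
  | coe x =>
    rw [← EReal.coe_mul]
    exact EReal.coe_ne_top _
  | top => exact absurd rfl he

end EPI

-- Passage to the limit of vanishing noise.

theorem theorem1 {n : ℕ} {Ω : Type*} [MeasurableSpace Ω] (P : Measure Ω) [IsProbabilityMeasure P]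
    (X₁ X₂ Z₁ Z₂ : Ω → EPI.Vec n)
    (hX₁ : Measurable X₁) (hX₂ : Measurable X₂) (hZ₁ : Measurable Z₁) (hZ₂ : Measurable Z₂)
    -- continuous random vectors with finite covariance matrices
    (hac₁ : P.map X₁ ≪ volume) (hac₂ : P.map X₂ ≪ volume)
    (hL₁ : MemLp X₁ 2 P) (hL₂ : MemLp X₂ 2 P)
    -- standard Gaussian noises, everything mutually independent
    (hG₁ : P.map Z₁ = stdGaussian (EPI.Vec n)) (hG₂ : P.map Z₂ = stdGaussian (EPI.Vec n))
    (hind : iIndepFun ![X₁, X₂, Z₁, Z₂] P)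
    (α : ℝ) (hα : α ∈ Icc (0 : ℝ) 1) :
    -- the three entropies are well defined elements of `[-∞, ∞)`
    EPI.HasEntropy (P.map X₁) ∧ EPI.HasEntropy (P.map X₂) ∧
      EPI.HasEntropy (P.map (EPI.mix α X₁ X₂)) ∧
    -- the exact deficit, unless the right-hand side is the undefined form `-∞ + ∞`
    ((((1 - α : ℝ) : EReal) * EPI.entropy P X₁ + (α : EReal) * EPI.entropy P X₂ ≠ ⊥ ∨
        EPI.deficit P X₁ X₂ Z₁ Z₂ α ≠ ∞) →
      EPI.entropy P (EPI.mix α X₁ X₂) =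
        ((1 - α : ℝ) : EReal) * EPI.entropy P X₁ + (α : EReal) * EPI.entropy P X₂
          + (EPI.deficit P X₁ X₂ Z₁ Z₂ α : EReal)) ∧
    -- Lieb's form of the entropy power inequality
    ((1 - α : ℝ) : EReal) * EPI.entropy P X₁ + (α : EReal) * EPI.entropy P X₂
      ≤ EPI.entropy P (EPI.mix α X₁ X₂) := by
  have h : EPI.GaussianChannels P X₁ X₂ Z₁ Z₂ :=
    ⟨hX₁, hX₂, hZ₁, hZ₂, hL₁, hL₂, hG₁, hG₂, hind⟩
  have hX := EPI.measurable_mix (α := α) hX₁ hX₂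
  have hX₁₂ : IndepFun X₁ X₂ P :=
    h.indep_channels.comp (φ := Prod.fst) (ψ := Prod.fst) measurable_fst measurable_fst
  have hac := EPI.map_mix_absolutelyContinuous hα hX₁ hX₂ hX₁₂ hac₁ hac₂
  have := Measure.isProbabilityMeasure_map (μ := P) hX₁.aemeasurable
  have := Measure.isProbabilityMeasure_map (μ := P) hX₂.aemeasurable
  have := Measure.isProbabilityMeasure_map (μ := P) hX.aemeasurable
  have m₁ := EPI.integrable_sq_norm_map hX₁ hL₁
  have m₂ := EPI.integrable_sq_norm_map hX₂ hL₂
  have m := EPI.integrable_sq_norm_map hX (EPI.memLp_mix hL₁ hL₂)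
  have E₁ := EPI.hasEntropy hac₁ m₁
  have E₂ := EPI.hasEntropy hac₂ m₂
  have E := EPI.hasEntropy hac m
  have hne : ∀ {V : Ω → EPI.Vec n}, EPI.HasEntropy (P.map V) → EPI.entropy P V ≠ ⊤ :=
    fun {V} hV => by
      have := hV.2
      unfold EPI.entropy
      lift EPI.entropyPos (P.map V) to NNReal using this with a
      induction EPI.entropyNeg (P.map V) with
      | top => exact bot_ne_top
      | coe b =>
        change ((a : ℝ) : EReal) - ((b : ℝ) : EReal) ≠ ⊤
        rw [← EReal.coe_sub]
        exact EReal.coe_ne_top _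
  -- The noise variances matching the signal-to-noise ratios k + 1.
  have ht : Tendsto (fun k : ℕ => ((k : ℝ) + 1)⁻¹) atTop (𝓝[>] 0) := by
    refine tendsto_nhdsWithin_iff.2 ⟨?_, Eventually.of_forall fun k => ?_⟩
    · simpa only [one_div] using tendsto_one_div_add_atTop_nhds_zero_nat (𝕜 := ℝ)
    · exact mem_Ioi.2 (by positivity)
  have l₁ := EPI.tendsto_coe_mul (1 - α) ((EPI.tendsto_noisyEntropy hac₁ m₁).comp ht)
  have l₂ := EPI.tendsto_coe_mul α ((EPI.tendsto_noisyEntropy hac₂ m₂).comp ht)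
  have l := (EPI.tendsto_noisyEntropy hac m).comp ht
  have lG := h.tendsto_entropyDeficit hα
  have n₁ := EPI.coe_mul_ne_top (c := 1 - α) (by linarith [hα.2]) (hne E₁)
  have n₂ := EPI.coe_mul_ne_top hα.1 (hne E₂)
  have ls := (EReal.continuousAt_add (p := (((1 - α : ℝ) : EReal) * EPI.entropy P X₁,
    (α : EReal) * EPI.entropy P X₂)) (Or.inl n₁) (Or.inr n₂)).tendsto.comp (l₁.prodMk_nhds l₂)
  have hs : ((1 - α : ℝ) : EReal) * EPI.entropy P X₁ + (α : EReal) * EPI.entropy P X₂ ≠ ⊤ :=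
    (EReal.add_lt_top n₁ n₂).ne
  have main : (((1 - α : ℝ) : EReal) * EPI.entropy P X₁ + (α : EReal) * EPI.entropy P X₂ ≠ ⊥ ∨
        EPI.deficit P X₁ X₂ Z₁ Z₂ α ≠ ∞) →
      EPI.entropy P (EPI.mix α X₁ X₂) =
        ((1 - α : ℝ) : EReal) * EPI.entropy P X₁ + (α : EReal) * EPI.entropy P X₂
          + (EPI.deficit P X₁ X₂ Z₁ Z₂ α : EReal) := fun hcond => by
    -- The weighted sum is never +∞ and the deficit never -∞, so the only obstruction to continuity
    -- of addition is -∞ + ∞, which `hcond` excludes.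
    have lsum := (EReal.continuousAt_add
      (p := (((1 - α : ℝ) : EReal) * EPI.entropy P X₁ + (α : EReal) * EPI.entropy P X₂,
        (EPI.deficit P X₁ X₂ Z₁ Z₂ α : EReal))) (Or.inl hs)
      (hcond.imp id fun hd => by simpa using hd)).tendsto.comp (ls.prodMk_nhds lG)
    -- At each finite ratio the identity holds between real numbers by the definition of the entropy
    -- deficit; both sides converge.
    refine tendsto_nhds_unique l (lsum.congr fun k => ?_)
    simp only [Function.comp_apply, ← EReal.coe_add]
    congr 1
    simp only [EPI.entropyDeficit]
    ring
  refine ⟨E₁, E₂, E, main, ?_⟩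
  by_cases hbot : ((1 - α : ℝ) : EReal) * EPI.entropy P X₁ + (α : EReal) * EPI.entropy P X₂ = ⊥
  · rw [hbot]
    exact bot_le
  · rw [main (Or.inl hbot)]
    exact le_add_of_nonneg_right (EReal.coe_ennreal_nonneg _)

end
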